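/- Let $K$ be a quadratic field with non-trivial automorphism $\sigma$ and algebraic closure $\overline{\mathbb Q}$. An elliptic curve $E/K$ is called a $\mathbb Q$-curve of degree $d$ if there is an isogeny $E\to E^\sigma$ over $\overline{\mathbb Q}$ with cyclic kernel of order $d$. For $n=dm$ with $(d,m)=1$, the non-cuspidal $\overline{\mathbb Q}$-points of $X_0(n)$ are the isomorphism classes of triples $(E,C_d,C_m)$, where $E/\overline{\mathbb Q}$ is an elliptic curve and $C_d$, $C_m$ are cyclic subgroups of orders $d$ and $m$ (equivalently, of pairs $(E,C)$ with $C=C_d+C_m$ cyclic of order $n$), and the Atkin–Lehner involution $w_d$ sends $(E,C_d,C_m)$ to $(E/C_d,\,E[d]/C_d,\,(C_m+C_d)/C_d)$. The non-cuspidal rational points on $X_0(n)/w_d$ are the $\operatorname{Gal}(\overline{\mathbb Q}/\mathbb Q)$-invariant orbits $\{x,w_d(x)\}$ of $w_d$ on these points. An elliptic curve $F$ corresponds to such a rational point if $j(F)$ is the $j$-invariant of the elliptic curve underlying $x$ or of the one underlying $w_d(x)$. Write $X_0^+(n)=X_0(n)/w_n$. Proposition. Let $d\ge 1$ be an integer and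 $m$ a prime with $(m,d)=1$. Let $E$ be an elliptic curve over a quadratic field $K$ without complex multiplication (that is, $\operatorname{End}_{\overline{\mathbb Q}}(E)=\mathbb Z$) which is a $\mathbb Q$-curve of degree $d$ and which has an $m$-isogeny over $K$, that is, there is an isogeny $E\to E'$ defined over $K$ with kernel cyclic of order $m$. Then either $E$ corresponds to a rational point on $X_0(dm)/w_d$, or $E$ is isogenous over $K$ to an elliptic curve $E_1/K$ which corresponds to a rational point on $X_0^+(dm^2)$ (the two cases are not claimed to exclude each other). -/

import Mathlib

noncomputable section

namespace QCurve

open WeierstrassCurve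

/-- The group of points of a Weierstrass curve over a field `Ω`. In the sequel `Ω` is an algebraic
closure, so these are the geometric points. -/
abbrev Pt {Ω : Type*} [Field Ω] (E : WeierstrassCurve Ω) : Type _ :=
  WeierstrassCurve.Affine.Point E.toAffine

/-- The `n`-torsion subgroup `A[n]`. -/
def torsion (A : Type*) [AddCommGroup A] (n : ℕ) : AddSubgroup A :=
  (nsmulAddMonoidHom (α := A) n).ker

/-! ### Isogenies -/

/-- The map `φ` is `(x, y) ↦ (u(x, y) / w(x, y), v(x, y) / w(x, y))` at all but finitely many
points. -/
def GivenBy {Ω : Type*} [Field Ω] {E₁ E₂ : WeierstrassCurve Ω} (φ : Pt E₁ → Pt E₂)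
    (u v w : Polynomial (Polynomial Ω)) : Prop :=
  {P : Pt E₁ | ¬ ∃ (x y : Ω) (h : E₁.toAffine.Nonsingular x y)
    (h' : E₂.toAffine.Nonsingular (u.evalEval x y / w.evalEval x y)
      (v.evalEval x y / w.evalEval x y)),
    P = .some x y h ∧ w.evalEval x y ≠ 0 ∧ φ P = .some _ _ h'}.Finite

/-- An isogeny between elliptic curves `E₁`, `E₂`, as a homomorphism on the points over the
algebraically closed field `Ω`: it is surjective, has finite kernel and is given by rational
functions. It is defined over the subfield `k` (over which `E₁` and `E₂` are to be defined) if the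
rational functions can be taken with coefficients in `k`. For isogenies over `Ω` take `k = Ω`.
In characteristic zero the degree is the order of the kernel. -/
structure IsIsogeny (k : Type*) {Ω : Type*} [Field k] [Field Ω] [DecidableEq Ω] [Algebra k Ω]
    {E₁ E₂ : WeierstrassCurve Ω} (φ : Pt E₁ →+ Pt E₂) : Prop where
  surjective : Function.Surjective φ
  finite_ker : Finite φ.ker
  rational : ∃ u v w : Polynomial (Polynomial k), GivenBy φ
    (u.map (Polynomial.mapRingHom (algebraMap k Ω)))
    (v.map (Polynomial.mapRingHom (algebraMap k Ω)))
    (w.map (Polynomial.mapRingHom (algebraMap k Ω)))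

/-- The kernel of `φ` is cyclic of order `n`. -/
def HasCyclicKernel {A B : Type*} [AddCommGroup A] [AddCommGroup B] (φ : A →+ B) (n : ℕ) : Prop :=
  IsAddCyclic φ.ker ∧ Nat.card φ.ker = n

/-- `E` has complex multiplication: some isogeny `E → E` over `Ω` is not the multiplication by an
integer. -/
def HasCM {Ω : Type*} [Field Ω] [DecidableEq Ω] (E : WeierstrassCurve Ω) : Prop :=
  ∃ φ : Pt E →+ Pt E, IsIsogeny Ω φ ∧ ∀ n : ℤ, φ ≠ n • AddMonoidHom.id (Pt E)

/-! ### Conjugation by field automorphisms -/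

section Conj

variable {Ω : Type*} [Field Ω]

/-- The conjugate curve `E^g`: `g` is applied to the coefficients. -/
abbrev conj (g : Ω ≃+* Ω) (E : WeierstrassCurve Ω) : WeierstrassCurve Ω :=
  E.map (g : Ω →+* Ω)

lemma conj_nonsingular (g : Ω ≃+* Ω) (E : WeierstrassCurve Ω) (x y : Ω) :
    (conj g E).toAffine.Nonsingular (g x) (g y) ↔ E.toAffine.Nonsingular x y :=
  Affine.map_nonsingular E.toAffine (f := (g : Ω →+* Ω)) g.injective x y

variable [DecidableEq Ω]

/-- The isomorphism `E(Ω) → E^g(Ω)`, `(x, y) ↦ (g x, g y)`. -/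
def conjPt (g : Ω ≃+* Ω) (E : WeierstrassCurve Ω) : Pt E ≃+ Pt (conj g E) where
  toFun P := match P with
    | .zero => .zero
    | .some x y h => .some (g x) (g y) ((conj_nonsingular g E x y).mpr h)
  invFun P := match P with
    | .zero => .zero
    | .some x y h => .some (g.symm x) (g.symm y)
        ((conj_nonsingular g E _ _).mp (by simpa using h))
  left_inv := by rintro (_ | ⟨x, y, h⟩) <;> simp
  right_inv := by rintro (_ | ⟨x, y, h⟩) <;> simp
  map_add' := by
    rintro (_ | ⟨x₁, y₁, h₁⟩) (_ | ⟨x₂, y₂, h₂⟩)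
    any_goals rfl
    have hn : (conj g E).toAffine.negY (g x₂) (g y₂) = g (E.toAffine.negY x₂ y₂) :=
      Affine.map_negY (W' := E.toAffine) (g : Ω →+* Ω) x₂ y₂
    by_cases hxy : x₁ = x₂ ∧ y₁ = E.toAffine.negY x₂ y₂
    · rw [Affine.Point.add_of_Y_eq hxy.left hxy.right]
      exact (Affine.Point.add_of_Y_eq (congrArg g hxy.1) (by rw [hn, hxy.2])).symm
    · have hxy' : ¬ (g x₁ = g x₂ ∧ g y₁ = (conj g E).toAffine.negY (g x₂) (g y₂)) := by
        rw [hn]; exact fun h => hxy ⟨g.injective h.1, g.injective h.2⟩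
      have hs := Affine.map_slope (W := E.toAffine) (g : Ω →+* Ω) x₁ x₂ y₁ y₂
      have hX := Affine.map_addX (W' := E.toAffine) (g : Ω →+* Ω) x₁ x₂
        (E.toAffine.slope x₁ x₂ y₁ y₂)
      have hY := Affine.map_addY (W' := E.toAffine) (g : Ω →+* Ω) x₁ y₁ x₂
        (E.toAffine.slope x₁ x₂ y₁ y₂)
      rw [← hs] at hX hY
      rw [Affine.Point.add_some hxy]
      refine Eq.trans ?_ (Affine.Point.add_some hxy').symm
      simp only [Affine.Point.some.injEq]
      exact ⟨hX.symm, hY.symm⟩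

/-- The conjugate `φ^g : E₁^g → E₂^g` of a homomorphism `φ : E₁ → E₂`. -/
def conjHom (g : Ω ≃+* Ω) {E₁ E₂ : WeierstrassCurve Ω} (φ : Pt E₁ →+ Pt E₂) :
    Pt (conj g E₁) →+ Pt (conj g E₂) :=
  (conjPt g E₂).toAddMonoidHom.comp (φ.comp (conjPt g E₁).symm.toAddMonoidHom)

lemma conjHom_conjPt (g : Ω ≃+* Ω) {E₁ E₂ : WeierstrassCurve Ω} (φ : Pt E₁ →+ Pt E₂) (P : Pt E₁) :
    conjHom g φ (conjPt g E₁ P) = conjPt g E₂ (φ P) := by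
  simp [conjHom]

lemma conjHom_ker (g : Ω ≃+* Ω) {E₁ E₂ : WeierstrassCurve Ω} (φ : Pt E₁ →+ Pt E₂) :
    (conjHom g φ).ker = φ.ker.map (conjPt g E₁).toAddMonoidHom := by
  ext P
  obtain ⟨P, rfl⟩ := (conjPt g E₁).surjective P
  simp [AddMonoidHom.mem_ker, conjHom_conjPt]

lemma conjHom_map (g : Ω ≃+* Ω) {E₁ E₂ : WeierstrassCurve Ω} (φ : Pt E₁ →+ Pt E₂)
    (A : AddSubgroup (Pt E₁)) :
    (A.map φ).map (conjPt g E₂).toAddMonoidHom =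
      (A.map (conjPt g E₁).toAddMonoidHom).map (conjHom g φ) := by
  rw [AddSubgroup.map_map, AddSubgroup.map_map]
  congr 1
  ext P
  simp [conjHom_conjPt]

lemma IsIsogeny.conj (g : Ω ≃+* Ω) {E₁ E₂ : WeierstrassCurve Ω} {φ : Pt E₁ →+ Pt E₂}
    (hφ : IsIsogeny Ω φ) : IsIsogeny Ω (conjHom g φ) where
  surjective Q := by
    obtain ⟨Q, rfl⟩ := (conjPt g E₂).surjective Q
    obtain ⟨P, rfl⟩ := hφ.surjective Q
    exact ⟨conjPt g E₁ P, conjHom_conjPt g φ P⟩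
  finite_ker := by
    have := hφ.finite_ker
    rw [conjHom_ker]
    exact Set.Finite.image _ (Set.toFinite (φ.ker : Set (Pt E₁)))
  rational := by
    obtain ⟨u, v, w, h⟩ := hφ.rational
    refine ⟨u.map (Polynomial.mapRingHom (g : Ω →+* Ω)), v.map (Polynomial.mapRingHom (g : Ω →+* Ω)),
      w.map (Polynomial.mapRingHom (g : Ω →+* Ω)), ?_⟩
    simp only [Algebra.algebraMap_self, Polynomial.mapRingHom_id, Polynomial.map_id, GivenBy]
      at h ⊢
    refine (h.image (conjPt g E₁)).subset fun Q hQ => ?_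
    obtain ⟨P, rfl⟩ := (conjPt g E₁).surjective Q
    refine ⟨P, fun hP => hQ ?_, rfl⟩
    obtain ⟨x, y, h₁, h₂, rfl, hw, hP⟩ := hP
    have ev (p : Polynomial (Polynomial Ω)) : (p.map (Polynomial.mapRingHom (g : Ω →+* Ω))).evalEval (g x) (g y) =
        g (p.evalEval x y) := Polynomial.map_mapRingHom_evalEval (g : Ω →+* Ω) p x y
    refine ⟨g x, g y, (conj_nonsingular g E₁ x y).mpr h₁, ?_, rfl, ?_, ?_⟩
    · simp only [ev, ← map_div₀]
      exact (conj_nonsingular g E₂ _ _).mpr h₂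
    · simpa [ev] using hw
    · rw [conjHom_conjPt, hP]
      change Affine.Point.some _ _ _ = _
      simp [ev]

lemma torsion_map_equiv {A B : Type*} [AddCommGroup A] [AddCommGroup B] (e : A ≃+ B) (n : ℕ) :
    (torsion A n).map e.toAddMonoidHom = torsion B n := by
  ext P
  obtain ⟨P, rfl⟩ := e.surjective P
  simp [torsion, AddMonoidHom.mem_ker, ← map_nsmul]

end Conj

/-! ### The modular curves `Y₀(n)` and their Atkin–Lehner quotients -/

section Modular

variable {Ω : Type*} [Field Ω]

/-- The affine substitution `x = u²X + r`, `y = u³Y + u²sX + t` takes the curve `V • E` with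
coordinates `X, Y` isomorphically to `E`. -/
lemma variableChange_nonsingular (V : VariableChange Ω) (E : WeierstrassCurve Ω) [E.IsElliptic]
    (x y : Ω) : (V • E).toAffine.Nonsingular x y ↔ E.toAffine.Nonsingular
      (V.u ^ 2 * x + V.r) (V.u ^ 3 * y + V.u ^ 2 * V.s * x + V.t) := by
  rw [← Affine.equation_iff_nonsingular, ← Affine.equation_iff_nonsingular, Affine.equation_iff',
    Affine.equation_iff']
  have hu : (V.u : Ω) ≠ 0 := V.u.ne_zero
  simp only [variableChange_def, Units.val_inv_eq_inv_val]
  rw [← mul_right_inj' (pow_ne_zero 6 hu), mul_zero]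
  refine Eq.congr ?_ rfl
  field_simp
  ring

variable [DecidableEq Ω]

variable (Ω) in
/-- A pair `(E, C)`: an elliptic curve over `Ω` with a cyclic subgroup of order `n`. For `n = dm`
with `(d, m) = 1` it is the same as a triple `(E, C_d, C_m)`, where `C_d = C[d]`, `C_m = C[m]`. -/
structure CyclicPair (n : ℕ) where
  E : WeierstrassCurve Ω
  elliptic : E.IsElliptic
  C : AddSubgroup (Pt E)
  cyclic : IsAddCyclic C
  card : Nat.card C = n

attribute [instance] CyclicPair.elliptic

/-- Two pairs are isomorphic if an isomorphism of elliptic curves (that is, a change of Weierstrass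
coordinates) matches the subgroups. -/
def CyclicPair.Iso {n : ℕ} (p q : CyclicPair Ω n) : Prop :=
  ∃ V : VariableChange Ω, V • p.E = q.E ∧
    ∀ (x y : Ω) (h : q.E.toAffine.Nonsingular x y) (h' : p.E.toAffine.Nonsingular
      (V.u ^ 2 * x + V.r) (V.u ^ 3 * y + V.u ^ 2 * V.s * x + V.t)),
      (Affine.Point.some x y h ∈ q.C ↔ Affine.Point.some _ _ h' ∈ p.C)

lemma mem_congr {E : WeierstrassCurve Ω} (C : AddSubgroup (Pt E)) {x y x' y' : Ω}
    (hx : x = x') (hy : y = y') (h : E.toAffine.Nonsingular x y)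
    (h' : E.toAffine.Nonsingular x' y') :
    (Affine.Point.some x y h : Pt E) ∈ C ↔ (Affine.Point.some x' y' h' : Pt E) ∈ C := by
  subst hx hy; rfl

lemma CyclicPair.Iso.refl {n : ℕ} (p : CyclicPair Ω n) : p.Iso p :=
  ⟨1, one_smul _ _, fun x y h h' => mem_congr _ (by simp [VariableChange.one_def])
    (by simp [VariableChange.one_def]) _ _⟩

lemma CyclicPair.Iso.symm {n : ℕ} {p q : CyclicPair Ω n} (h : p.Iso q) : q.Iso p := by
  obtain ⟨V, hV, H⟩ := h
  refine ⟨V⁻¹, by rw [← hV, inv_smul_smul], fun x y h h' => ?_⟩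
  have hu : (V.u : Ω) ≠ 0 := V.u.ne_zero
  have h'' := h'
  rw [show q.E = V • p.E from hV.symm, variableChange_nonsingular] at h''
  rw [H _ _ h' h'']
  refine mem_congr _ ?_ ?_ _ _ <;> simp [VariableChange.inv_def] <;> field_simp <;> ring

lemma CyclicPair.Iso.trans {n : ℕ} {p q r : CyclicPair Ω n} (h₁ : p.Iso q) (h₂ : q.Iso r) :
    p.Iso r := by
  obtain ⟨V, hV, H⟩ := h₁
  obtain ⟨W, hW, H'⟩ := h₂
  refine ⟨W * V, by rw [mul_smul, hV, hW], fun x y h h' => ?_⟩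
  have h₁ := h
  rw [show r.E = W • q.E from hW.symm, variableChange_nonsingular] at h₁
  have h₂ := h₁
  rw [show q.E = V • p.E from hV.symm, variableChange_nonsingular] at h₂
  rw [H' _ _ h h₁, H _ _ h₁ h₂]
  refine mem_congr _ ?_ ?_ _ _ <;> simp [VariableChange.mul_def] <;> ring

variable (Ω) in
/-- Isomorphism of pairs `(E, C)`. -/
instance CyclicPair.setoid (n : ℕ) : Setoid (CyclicPair Ω n) :=
  ⟨CyclicPair.Iso, CyclicPair.Iso.refl, CyclicPair.Iso.symm, CyclicPair.Iso.trans⟩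

variable (Ω) in
/-- The points of `Y₀(n)` over the algebraically closed field `Ω`: isomorphism classes of pairs
`(E, C)`. -/
def Y0 (n : ℕ) : Type _ := Quotient (CyclicPair.setoid Ω n)

/-- The `j`-invariant of the point `(E, C)`. -/
def Y0.j {n : ℕ} : Y0 Ω n → Ω :=
  Quotient.lift (fun p => p.E.j) (by
    rintro ⟨E, hE, C, _, _⟩ ⟨E', hE', C', _, _⟩ ⟨V, hV, _⟩
    dsimp only at hV ⊢
    subst hV
    exact (variableChange_j E V).symm)

/-- The conjugate pair `(E^g, C^g)`. -/
def CyclicPair.conj {n : ℕ} (g : Ω ≃+* Ω) (p : CyclicPair Ω n) : CyclicPair Ω n where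
  E := QCurve.conj g p.E
  elliptic := inferInstance
  C := p.C.map (conjPt g p.E).toAddMonoidHom
  cyclic := by
    have := p.cyclic
    exact isAddCyclic_of_surjective ((conjPt g p.E).addSubgroupMap p.C)
      ((conjPt g p.E).addSubgroupMap p.C).surjective
  card := (Nat.card_congr ((conjPt g p.E).addSubgroupMap p.C).toEquiv).symm.trans p.card

lemma CyclicPair.Iso.conj {n : ℕ} (g : Ω ≃+* Ω) {p q : CyclicPair Ω n} (h : p.Iso q) :
    (p.conj g).Iso (q.conj g) := by
  obtain ⟨V, hV, H⟩ := h
  refine ⟨V.map (g : Ω →+* Ω), ?_, fun x y h h' => ?_⟩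
  · change V.map (g : Ω →+* Ω) • p.E.map (g : Ω →+* Ω) = q.E.map (g : Ω →+* Ω)
    rw [map_variableChange, hV]
  · obtain ⟨x, rfl⟩ := g.surjective x
    obtain ⟨y, rfl⟩ := g.surjective y
    have h₁ := (conj_nonsingular g q.E x y).mp h
    have h₂ := h₁
    rw [show q.E = V • p.E from hV.symm, variableChange_nonsingular] at h₂
    have key (r : CyclicPair Ω n) (P : Pt r.E) : conjPt g r.E P ∈ (r.conj g).C ↔ P ∈ r.C :=
      AddSubgroup.mem_map_equiv.trans (by simp)
    refine (key q (.some x y h₁)).trans ((H x y h₁ h₂).trans ((key p (.some _ _ h₂)).symm.trans ?_))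
    refine mem_congr _ ?_ ?_ _ h' <;> simp [VariableChange.map]

/-- The action of field automorphisms of `Ω` on the points of `Y₀(n)`. -/
def Y0.conj {n : ℕ} (g : Ω ≃+* Ω) : Y0 Ω n → Y0 Ω n :=
  Quotient.map (CyclicPair.conj g) fun _ _ h => CyclicPair.Iso.conj g h

/-- There is an isogeny `μ : E₁ → E₂` with kernel `C₁[d]` such that `C₂ = μ(E₁[d]) + μ(C₁[m])`. -/
def IsQuotientBy (d m : ℕ) {E₁ E₂ : WeierstrassCurve Ω} (C₁ : AddSubgroup (Pt E₁))
    (C₂ : AddSubgroup (Pt E₂)) : Prop :=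
  ∃ μ : Pt E₁ →+ Pt E₂, IsIsogeny Ω μ ∧ μ.ker = C₁ ⊓ torsion (Pt E₁) d ∧
    C₂ = (torsion (Pt E₁) d).map μ ⊔ (C₁ ⊓ torsion (Pt E₁) m).map μ

lemma IsQuotientBy.conj {d m : ℕ} (g : Ω ≃+* Ω) {E₁ E₂ : WeierstrassCurve Ω}
    {C₁ : AddSubgroup (Pt E₁)} {C₂ : AddSubgroup (Pt E₂)} (h : IsQuotientBy d m C₁ C₂) :
    IsQuotientBy d m (C₁.map (conjPt g E₁).toAddMonoidHom)
      (C₂.map (conjPt g E₂).toAddMonoidHom) := by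
  obtain ⟨μ, hμ, hk, hC⟩ := h
  have hinf (k : ℕ) : (C₁ ⊓ torsion (Pt E₁) k).map (conjPt g E₁).toAddMonoidHom =
      C₁.map (conjPt g E₁).toAddMonoidHom ⊓ torsion (Pt (QCurve.conj g E₁)) k := by
    rw [AddSubgroup.map_inf _ _ _ (conjPt g E₁).injective, torsion_map_equiv]
  refine ⟨conjHom g μ, hμ.conj g, ?_, ?_⟩
  · rw [conjHom_ker, hk, hinf]
  · rw [hC, AddSubgroup.map_sup, conjHom_map, conjHom_map, torsion_map_equiv, hinf]

/-- The graph of the Atkin–Lehner involution `w_d` on pairs, where `d ∣ n` and `(d, n/d) = 1`: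
with `m = n/d`, `C_d = C[d]` and `C_m = C[m]` for `p = (E, C)`, the pair `q` is isomorphic to
`(E/C_d, E[d]/C_d + (C_m + C_d)/C_d)`. -/
def AtkinLehner {n : ℕ} (d : ℕ) (p q : CyclicPair Ω n) : Prop :=
  IsQuotientBy d (n / d) p.C q.C

lemma AtkinLehner.conj {n d : ℕ} (g : Ω ≃+* Ω) {p q : CyclicPair Ω n} (h : AtkinLehner d p q) :
    AtkinLehner d (p.conj g) (q.conj g) :=
  IsQuotientBy.conj g h

variable (Ω) in
/-- The non-cuspidal points over `Ω` of `X₀(n)/w_d`, where `d ∣ n` and `(d, n/d) = 1`: the quotient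
of the points of `Y₀(n)` by `w_d`. -/
def Y0Quot (n d : ℕ) : Type _ :=
  Quot fun x y : Y0 Ω n => ∃ p q : CyclicPair Ω n,
    x = Quotient.mk _ p ∧ y = Quotient.mk _ q ∧ AtkinLehner d p q

/-- The quotient map `Y₀(n) → Y₀(n)/w_d` on points. -/
def Y0Quot.mk {n : ℕ} (d : ℕ) (x : Y0 Ω n) : Y0Quot Ω n d := Quot.mk _ x

/-- The action of field automorphisms of `Ω` on the points of `Y₀(n)/w_d`. -/
def Y0Quot.conj {n d : ℕ} (g : Ω ≃+* Ω) : Y0Quot Ω n d → Y0Quot Ω n d :=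
  Quot.map (Y0.conj g) (by
    rintro _ _ ⟨p, q, rfl, rfl, h⟩
    exact ⟨p.conj g, q.conj g, rfl, rfl, h.conj g⟩)

/-- The point of `Y₀(n)/w_d` is rational over `ℚ`, that is invariant under the Galois group of
`Ω/ℚ`; here `Ω` is an algebraic closure of `ℚ`. -/
def Y0Quot.IsRational [Algebra ℚ Ω] {n d : ℕ} (z : Y0Quot Ω n d) : Prop :=
  ∀ g : Ω ≃ₐ[ℚ] Ω, z.conj (g : Ω ≃+* Ω) = z

/-- The elliptic curve `F` corresponds to a rational point on `X₀(n)/w_d`: for some non-cuspidal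
rational point `{x, w_d x}` of it, `j(F) = j(x)` or `j(F) = j(w_d x)`. -/
def Corresponds [Algebra ℚ Ω] (F : WeierstrassCurve Ω) [F.IsElliptic] (n d : ℕ) : Prop :=
  ∃ z : Y0Quot Ω n d, z.IsRational ∧ ∃ x : Y0 Ω n, Y0Quot.mk d x = z ∧ x.j = F.j

end Modular

/-! ### Elliptic curves over a number field -/

section Field

variable {K : Type*} [Field K]

/-- The base change of `E` to the algebraic closure. -/
abbrev geom (E : WeierstrassCurve K) : WeierstrassCurve (AlgebraicClosure K) :=
  E.map (algebraMap K (AlgebraicClosure K))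

variable [DecidableEq (AlgebraicClosure K)]

/-- `E` is isogenous over `K` to `E'`. -/
def IsogenousOver (E E' : WeierstrassCurve K) : Prop :=
  ∃ φ : Pt (geom E) →+ Pt (geom E'), IsIsogeny K φ

/-- `E` has an `m`-isogeny over `K`: an isogeny defined over `K` with cyclic kernel of order `m`. -/
def HasIsogenyOfDegree (E : WeierstrassCurve K) (m : ℕ) : Prop :=
  ∃ E' : WeierstrassCurve K, E'.IsElliptic ∧
    ∃ φ : Pt (geom E) →+ Pt (geom E'), IsIsogeny K φ ∧ HasCyclicKernel φ m

/-- `E` over the quadratic field `K` is a `ℚ`-curve of degree `d`: there is a cyclic isogeny of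
degree `d` over the algebraic closure from `E` to its conjugate `E^σ`, where `σ` is the non-trivial
automorphism of `K`. -/
def IsQCurveOfDegree [Algebra ℚ K] (E : WeierstrassCurve K) (d : ℕ) : Prop :=
  ∃ σ : K ≃ₐ[ℚ] K, σ ≠ 1 ∧ ∃ μ : Pt (geom E) →+ Pt (geom (E.map (σ : K →+* K))),
    IsIsogeny (AlgebraicClosure K) μ ∧ HasCyclicKernel μ d

end Field

end QCurve

end

/-! Let `φ : E → E'` be the given `m`-isogeny over `K` and `μ : E → E^σ` the cyclic isogeny of
degree `d`. Everything depends on whether conjugation carries `ker φ` to `μ(ker φ)`.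

Suppose `g(ker φ) = μ(ker φ)` for every automorphism `g` of the algebraic closure that extends `σ`.
Then `(E, ker μ + ker φ)` gives a rational point on `X₀(dm)/w_d`. An automorphism `g` fixing `K`
preserves `ker φ` because `φ` is defined over `K`, and preserves `ker μ` because `μ^g = ±μ`. If `g`
extends `σ`, then `μ^g ∘ μ = ±d`, so `g(ker μ) = ker μ^g = μ(E[d])`, and `g` acts on the pair as
`w_d`.

Otherwise some `ρ` extending `σ` has `ker φ^ρ ≠ μ(ker φ)`. With `ψ` the dual of `φ`, consider `χ =
φ^ρ ∘ μ ∘ ψ : E' → E → E^σ → E'^σ`. The inequality of kernels prevents any cancellation, so `ker χ`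
is cyclic of order `dm²` (`hasCyclicKernel_comp`). The same sign argument gives `g(ker χ) = ker χ`
when `g` fixes `K`, and `χ^g ∘ χ = ±dm²` when `g` extends `σ`. Hence `(E', ker χ)` gives a rational
point on `X₀⁺(dm²)`, and `φ` itself is the isogeny over `K`.

The signs come from the absence of complex multiplication (`comp_eq_of_not_hasCM`,
`eq_or_eq_neg_of_not_hasCM`): a composite of two isogenies of degree `d` that returns to `E` is an
integer `n`, and counting kernels gives `n² = d²`. This needs `|E[n]| = n²` (`card_torsion`) and the
existence of the dual (`IsIsogeny.exists_dual`). Both are obtained from rational functions on the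
set of points: `card_torsion` from a convexity inequality for `|E[n]|`, the dual by showing that a
function on the target of an isogeny is rational when its pullback is (`IsRat.of_comp`). -/

noncomputable section

namespace QCurve

open WeierstrassCurve Polynomial Filter

/-! ### Coordinates of points and the finiteness of the fibres of `x`. -/

section Coordinates

variable {Ω : Type*} [Field Ω] {E : WeierstrassCurve Ω}

/-- The `x`-coordinate of a point, `0` at the point at infinity. -/
def xc : Pt E → Ω
  | .zero => 0
  | .some x _ _ => x

/-- The `y`-coordinate of a point, `0` at the point at infinity. -/
def yc : Pt E → Ω
  | .zero => 0
  | .some _ y _ => y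

@[simp] lemma xc_some {x y : Ω} (h : E.toAffine.Nonsingular x y) :
    xc (Affine.Point.some x y h : Pt E) = x := rfl

@[simp] lemma yc_some {x y : Ω} (h : E.toAffine.Nonsingular x y) :
    yc (Affine.Point.some x y h : Pt E) = y := rfl

lemma Pt.exists_some {P : Pt E} (hP : P ≠ 0) :
    ∃ x y h, P = Affine.Point.some x y h := by
  rcases P with _ | ⟨x, y, h⟩
  · exact absurd rfl hP
  · exact ⟨x, y, h, rfl⟩

lemma Pt.equation {P : Pt E} (hP : P ≠ 0) :
    yc P ^ 2 + E.a₁ * xc P * yc P + E.a₃ * yc P =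
      xc P ^ 3 + E.a₂ * xc P ^ 2 + E.a₄ * xc P + E.a₆ := by
  obtain ⟨x, y, h, rfl⟩ := Pt.exists_some hP
  exact (Affine.equation_iff x y).mp h.1

@[simp] lemma xc_neg (P : Pt E) : xc (-P) = xc P := by
  rcases P with _ | ⟨x, y, h⟩ <;> rfl

lemma yc_neg {P : Pt E} (hP : P ≠ 0) : yc (-P) = -yc P - E.a₁ * xc P - E.a₃ := by
  obtain ⟨x, y, h, rfl⟩ := Pt.exists_some hP
  rfl

lemma Pt.ext_coord {P Q : Pt E} (hP : P ≠ 0) (hQ : Q ≠ 0) (hx : xc P = xc Q)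
    (hy : yc P = yc Q) : P = Q := by
  obtain ⟨x, y, h, rfl⟩ := Pt.exists_some hP
  obtain ⟨x', y', h', rfl⟩ := Pt.exists_some hQ
  simp only [xc_some, yc_some] at hx hy
  subst hx hy; rfl

lemma Pt.eq_or_eq_neg {P Q : Pt E} (hP : P ≠ 0) (hQ : Q ≠ 0) (h : xc P = xc Q) :
    P = Q ∨ P = -Q := by
  obtain ⟨x, y, h, rfl⟩ := Pt.exists_some hP
  obtain ⟨x', y', h', rfl⟩ := Pt.exists_some hQ
  exact Affine.Point.X_eq_iff.mp h

lemma finite_xc_fiber (t : Ω) : (xc (E := E) ⁻¹' {t}).Finite := by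
  by_cases h : ∃ P : Pt E, P ≠ 0 ∧ xc P = t
  · obtain ⟨P, hP, rfl⟩ := h
    refine (Set.toFinite {0, P, -P}).subset fun Q hQ => ?_
    by_cases hQ0 : Q = 0
    · simp [hQ0]
    · rcases Pt.eq_or_eq_neg hQ0 hP hQ with h | h <;> simp [h]
  · push Not at h
    refine (Set.toFinite {0}).subset fun Q hQ => ?_
    by_contra hQ0
    exact h Q hQ0 hQ

lemma tendsto_xc : Tendsto (xc (E := E)) cofinite cofinite :=
  Tendsto.cofinite_of_finite_preimage_singleton finite_xc_fiber

lemma eventually_ne_pt (P : Pt E) : ∀ᶠ Q : Pt E in cofinite, Q ≠ P :=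
  (Set.finite_singleton P).compl_mem_cofinite

lemma eventually_eval_ne_zero {p : Polynomial Ω} (hp : p ≠ 0) : ∀ᶠ t in cofinite, p.eval t ≠ 0 := by
  have h := (p.finite_setOfPred_isRoot hp).compl_mem_cofinite
  filter_upwards [h] with t ht using ht

lemma eventually_eval_xc_ne_zero {p : Polynomial Ω} (hp : p ≠ 0) :
    ∀ᶠ P : Pt E in cofinite, p.eval (xc P) ≠ 0 :=
  tendsto_xc.eventually (eventually_eval_ne_zero hp)

variable [IsAlgClosed Ω] [E.IsElliptic]

lemma exists_xc_eq (t : Ω) : ∃ P : Pt E, P ≠ 0 ∧ xc P = t := by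
  obtain ⟨y, hy⟩ := IsAlgClosed.exists_root
    (X ^ 2 + C (E.a₁ * t + E.a₃) * X + C (-(t ^ 3 + E.a₂ * t ^ 2 + E.a₄ * t + E.a₆)) : Polynomial Ω)
    (by
      have : (X ^ 2 + C (E.a₁ * t + E.a₃) * X +
        C (-(t ^ 3 + E.a₂ * t ^ 2 + E.a₄ * t + E.a₆)) : Polynomial Ω).degree = 2 := by compute_degree!
      rw [this]; decide)
  have h : E.toAffine.Equation t y := by
    rw [Affine.equation_iff]
    simp only [IsRoot.def, eval_add, eval_pow, eval_X, eval_mul, eval_C] at hy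
    linear_combination hy
  exact ⟨.some t y (Affine.equation_iff_nonsingular.mp h), Affine.Point.some_ne_zero _, rfl⟩

instance infinite_pt : Infinite (Pt E) := by
  have : Infinite Ω := IsAlgClosed.instInfinite
  exact Infinite.of_surjective (xc (E := E)) fun t => (exists_xc_eq t).imp fun _ h => h.2

end Coordinates

/-! ### Rational functions on the set of points -/

section Rational

variable {Ω : Type*} [Field Ω] {E : WeierstrassCurve Ω}

/-- The function `f` on the points of `E` is a rational function outside a finite set, written in
the normal form `(a(x) + b(x) y) / c(x)`. -/
def IsRat (f : Pt E → Ω) : Prop :=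
  ∃ a b c : Polynomial Ω, c ≠ 0 ∧
    ∀ᶠ P in cofinite, f P = (a.eval (xc P) + b.eval (xc P) * yc P) / c.eval (xc P)

namespace IsRat

variable {f g : Pt E → Ω}

lemma congr (hf : IsRat f) (h : f =ᶠ[cofinite] g) : IsRat g := by
  obtain ⟨a, b, c, hc, H⟩ := hf
  refine ⟨a, b, c, hc, ?_⟩
  filter_upwards [H, h] with P h₁ h₂ using h₂ ▸ h₁

lemma const (t : Ω) : IsRat (fun _ : Pt E => t) :=
  ⟨C t, 0, 1, one_ne_zero, by simp⟩

lemma x : IsRat (xc (E := E)) := ⟨X, 0, 1, one_ne_zero, by simp⟩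

lemma y : IsRat (yc (E := E)) := ⟨0, 1, 1, one_ne_zero, by simp⟩

lemma add (hf : IsRat f) (hg : IsRat g) : IsRat (fun P => f P + g P) := by
  obtain ⟨a, b, c, hc, H⟩ := hf
  obtain ⟨a', b', c', hc', H'⟩ := hg
  refine ⟨a * c' + a' * c, b * c' + b' * c, c * c', mul_ne_zero hc hc', ?_⟩
  filter_upwards [H, H', eventually_eval_xc_ne_zero hc, eventually_eval_xc_ne_zero hc']
    with P h₁ h₂ h₃ h₄
  rw [h₁, h₂]
  simp only [eval_add, eval_mul]
  field_simp
  ring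

lemma mul (hf : IsRat f) (hg : IsRat g) : IsRat (fun P => f P * g P) := by
  obtain ⟨a, b, c, hc, H⟩ := hf
  obtain ⟨a', b', c', hc', H'⟩ := hg
  refine ⟨a * a' + b * b' * (X ^ 3 + C E.a₂ * X ^ 2 + C E.a₄ * X + C E.a₆),
    a * b' + a' * b - b * b' * (C E.a₁ * X + C E.a₃), c * c', mul_ne_zero hc hc', ?_⟩
  filter_upwards [H, H', eventually_eval_xc_ne_zero hc, eventually_eval_xc_ne_zero hc',
    eventually_ne_pt 0] with P h₁ h₂ h₃ h₄ h₅
  have := Pt.equation h₅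
  rw [h₁, h₂]
  simp only [eval_add, eval_sub, eval_mul, eval_pow, eval_X, eval_C]
  rw [div_mul_div_comm]
  congr 1
  linear_combination (b.eval (xc P) * b'.eval (xc P)) * this

lemma neg (hf : IsRat f) : IsRat (fun P => -f P) :=
  ((const (-1)).mul hf).congr (.of_forall fun P => by ring)

lemma sub (hf : IsRat f) (hg : IsRat g) : IsRat (fun P => f P - g P) :=
  (hf.add hg.neg).congr (.of_forall fun P => by ring)

lemma const_mul (t : Ω) (hf : IsRat f) : IsRat (fun P => t * f P) := (const t).mul hf

lemma pow (hf : IsRat f) (n : ℕ) : IsRat (fun P => f P ^ n) := by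
  induction n with
  | zero => simpa using const 1
  | succ n ih => simpa only [pow_succ] using ih.mul hf

lemma eval (hf : IsRat f) (p : Polynomial Ω) : IsRat (fun P => p.eval (f P)) := by
  induction p using Polynomial.induction_on' with
  | add p q hp hq => simpa only [eval_add] using hp.add hq
  | monomial n t => simpa only [eval_monomial] using (hf.pow n).const_mul t

lemma evalEval (hf : IsRat f) (hg : IsRat g) (p : Polynomial (Polynomial Ω)) :
    IsRat (fun P => p.evalEval (f P) (g P)) := by
  induction p using Polynomial.induction_on' with
  | add p q hp hq => simpa only [evalEval_add] using hp.add hq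
  | monomial n t =>
    refine ((hf.eval t).mul (hg.pow n)).congr (.of_forall fun P => ?_)
    simp [Polynomial.evalEval, eval_monomial]

lemma comp_neg (hf : IsRat f) : IsRat (fun P => f (-P)) := by
  obtain ⟨a, b, c, hc, H⟩ := hf
  refine ⟨a - b * (C E.a₁ * X + C E.a₃), -b, c, hc, ?_⟩
  have hneg : Tendsto (fun P : Pt E => -P) cofinite cofinite :=
    neg_injective.tendsto_cofinite
  filter_upwards [hneg.eventually H, eventually_ne_pt 0] with P h₁ h₂
  rw [h₁, xc_neg, yc_neg h₂]
  simp only [eval_add, eval_sub, eval_neg, eval_mul, eval_X, eval_C]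
  ring

/-- A rational function that is zero at infinitely many points is zero at almost all points; its
inverse is rational. -/
lemma inv_aux (hf : IsRat f) :
    (∀ᶠ P in cofinite, f P = 0) ∨ ((∀ᶠ P in cofinite, f P ≠ 0) ∧ IsRat fun P => (f P)⁻¹) := by
  obtain ⟨a, b, c, hc, H⟩ := hf
  -- `N` is the norm of `a + b y`, its product with the conjugate under `y ↦ -y - a₁x - a₃`. Its
  -- degree is the maximum of `2 deg a` and `2 deg b + 3`, so `N = 0` forces `a = b = 0`. Otherwise
  -- multiplying by the conjugate moves `y` out of the denominator.
  set N : Polynomial Ω := a ^ 2 - a * b * (C E.a₁ * X + C E.a₃) -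
    b ^ 2 * (X ^ 3 + C E.a₂ * X ^ 2 + C E.a₄ * X + C E.a₆) with hN
  by_cases hN0 : N = 0
  · left
    have hd := Affine.CoordinateRing.degree_norm_smul_basis (W' := E.toAffine) a b
    rw [Affine.CoordinateRing.norm_smul_basis, ← hN, hN0, degree_zero] at hd
    obtain ⟨ha, hb⟩ : a = 0 ∧ b = 0 := by
      have h := max_eq_bot.mp hd.symm
      constructor
      · by_contra h0
        have h1 := h.1
        rw [degree_eq_natDegree h0] at h1
        exact absurd h1 (by
          rw [← Nat.cast_ofNat, ← Nat.cast_smul_eq_nsmul ℕ]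
          exact WithBot.coe_ne_bot)
      · by_contra h0
        have h1 := h.2
        rw [degree_eq_natDegree h0] at h1
        exact absurd h1 (by exact WithBot.coe_ne_bot)
    filter_upwards [H] with P hP
    simp [hP, ha, hb]
  · right
    have key : ∀ᶠ P : Pt E in cofinite, N.eval (xc P) = (a.eval (xc P) + b.eval (xc P) * yc P) *
        (a.eval (xc P) - b.eval (xc P) * (E.a₁ * xc P + E.a₃) - b.eval (xc P) * yc P) := by
      filter_upwards [eventually_ne_pt 0] with P hP
      have := Pt.equation hP
      simp only [hN, eval_add, eval_sub, eval_mul, eval_pow, eval_X, eval_C]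
      linear_combination (b.eval (xc P)) ^ 2 * this
    refine ⟨?_, c * (a - b * (C E.a₁ * X + C E.a₃)), -(c * b), N, hN0, ?_⟩
    · filter_upwards [H, key, eventually_eval_xc_ne_zero hc, eventually_eval_xc_ne_zero hN0]
        with P h₁ h₂ h₃ h₄
      rw [h₁]
      exact div_ne_zero (left_ne_zero_of_mul (h₂ ▸ h₄)) h₃
    · filter_upwards [H, key, eventually_eval_xc_ne_zero hc, eventually_eval_xc_ne_zero hN0]
        with P h₁ h₂ h₃ h₄
      have h₅ := left_ne_zero_of_mul (h₂ ▸ h₄)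
      rw [h₁, inv_div, div_eq_div_iff h₅ h₄, h₂]
      simp only [eval_add, eval_sub, eval_neg, eval_mul, eval_X, eval_C]
      ring

lemma eventually_zero_or_ne_zero (hf : IsRat f) :
    (∀ᶠ P in cofinite, f P = 0) ∨ (∀ᶠ P in cofinite, f P ≠ 0) :=
  hf.inv_aux.imp_right And.left

lemma inv (hf : IsRat f) : IsRat (fun P => (f P)⁻¹) := by
  rcases hf.inv_aux with h | h
  · refine (const 0).congr ?_
    filter_upwards [h] with P hP
    simp [hP]
  · exact h.2

lemma div (hf : IsRat f) (hg : IsRat g) : IsRat (fun P => f P / g P) := by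
  simpa only [div_eq_mul_inv] using hf.mul hg.inv

/-- An even rational function is a rational function of `x`. -/
lemma exists_of_even [CharZero Ω] (hf : IsRat f) (he : ∀ᶠ P in cofinite, f (-P) = f P) :
    ∃ A D : Polynomial Ω, IsCoprime A D ∧ D ≠ 0 ∧
      ∀ᶠ P : Pt E in cofinite, D.eval (xc P) ≠ 0 ∧ f P * D.eval (xc P) = A.eval (xc P) := by
  classical
  obtain ⟨a, b, c, hc, H⟩ := hf
  have hneg : Tendsto (fun P : Pt E => -P) cofinite cofinite :=
    neg_injective.tendsto_cofinite
  -- Adding the values at `P` and `-P` eliminates `y`, since `y(P) + y(-P) = -(a₁x + a₃)`. So `2f`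
  -- is a fraction in `x` alone, which is then reduced to lowest terms.
  obtain ⟨A, D, hAD, hD, hq⟩ : ∃ A D : Polynomial Ω, IsCoprime A D ∧ D ≠ 0 ∧
      (2 * a - b * (C E.a₁ * X + C E.a₃)) * D = A * (2 * c) := by
    have h2c : (2 * c) ≠ 0 := mul_ne_zero two_ne_zero hc
    set n := 2 * a - b * (C E.a₁ * X + C E.a₃)
    have hg : EuclideanDomain.gcd n (2 * c) ≠ 0 := fun h =>
      h2c (EuclideanDomain.gcd_eq_zero_iff.mp h).2
    obtain ⟨A, hA⟩ := EuclideanDomain.gcd_dvd_left n (2 * c)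
    obtain ⟨D, hD⟩ := EuclideanDomain.gcd_dvd_right n (2 * c)
    refine ⟨A, D, ?_, ?_, ?_⟩
    · have hb := EuclideanDomain.gcd_eq_gcd_ab n (2 * c)
      refine ⟨EuclideanDomain.gcdA n (2 * c), EuclideanDomain.gcdB n (2 * c), ?_⟩
      apply mul_left_cancel₀ hg
      linear_combination -hb - EuclideanDomain.gcdA n (2 * c) * hA -
        EuclideanDomain.gcdB n (2 * c) * hD
    · rintro rfl
      exact h2c (by rw [hD, mul_zero])
    · linear_combination D * hA - A * hD
  refine ⟨A, D, hAD, hD, ?_⟩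
  filter_upwards [H, hneg.eventually H, he, eventually_eval_xc_ne_zero hc,
    eventually_eval_xc_ne_zero hD, eventually_ne_pt 0] with P h₁ h₂ h₃ h₄ h₅ h₆
  refine ⟨h₅, ?_⟩
  have hq' := congrArg (Polynomial.eval (xc P)) hq
  rw [xc_neg, yc_neg h₆, h₃] at h₂
  rw [eq_div_iff h₄] at h₁ h₂
  simp only [eval_mul, eval_sub, eval_add, eval_X, eval_C, eval_ofNat] at hq'
  have h2 : (2 : Ω) ≠ 0 := two_ne_zero
  apply mul_left_cancel₀ (mul_ne_zero h2 h₄)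
  linear_combination hq' + D.eval (xc P) * (h₁ + h₂)

end IsRat

end Rational

end QCurve

end

noncomputable section

namespace QCurve

open WeierstrassCurve Polynomial Filter

/-! ### Rational homomorphisms -/

lemma tendsto_cofinite_of_finite_ker {A B : Type*} [AddCommGroup A] [AddCommGroup B] {φ : A →+ B}
    (h : Finite φ.ker) : Tendsto φ cofinite cofinite := by
  refine Tendsto.cofinite_of_finite_preimage_singleton fun b => ?_
  by_cases hb : ∃ a, φ a = b
  · obtain ⟨a, rfl⟩ := hb
    refine ((Set.toFinite (φ.ker : Set A)).image (a + ·)).subset fun c hc => ?_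
    exact ⟨c - a, by simpa [AddMonoidHom.mem_ker, sub_eq_zero] using hc, by simp⟩
  · push Not at hb
    rw [show φ ⁻¹' {b} = ∅ from Set.eq_empty_of_forall_notMem fun a ha => hb a ha]
    exact Set.finite_empty

lemma eventually_map_ne {A B : Type*} [AddCommGroup A] [AddCommGroup B] {φ : A →+ B}
    (h : Finite φ.ker) (b : B) : ∀ᶠ a in cofinite, φ a ≠ b :=
  (tendsto_cofinite_of_finite_ker h).eventually (Set.finite_singleton b).compl_mem_cofinite

/-- A subgroup that contains almost all elements of an infinite group is the whole group. -/
lemma addSubgroup_eq_top_of_eventually {A : Type*} [AddCommGroup A] [Infinite A]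
    {H : AddSubgroup A} (h : ∀ᶠ a in cofinite, a ∈ H) : H = ⊤ := by
  rw [eq_top_iff]
  rintro a -
  have ht : Tendsto (fun b => a - b) cofinite cofinite := (sub_right_injective).tendsto_cofinite
  obtain ⟨b, hb, hb'⟩ := (h.and (ht.eventually h)).exists
  simpa using H.add_mem hb' hb

/-- The locus of agreement is a subgroup containing almost all elements, hence everything. This
turns identities of rational functions, known only off a finite set, into identities of
homomorphisms. -/
lemma addMonoidHom_eq_of_eventuallyEq {A B : Type*} [AddCommGroup A] [Infinite A] [AddCommGroup B]
    {φ ψ : A →+ B} (h : ∀ᶠ a in cofinite, φ a = ψ a) : φ = ψ := by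
  have := addSubgroup_eq_top_of_eventually (H := φ.eqLocus ψ) h
  exact AddMonoidHom.eq_of_eqOn_top fun x _ => by
    have : x ∈ φ.eqLocus ψ := this ▸ AddSubgroup.mem_top x
    exact this

/-! ### The fibres of a rational function of one variable -/

section Fibres

variable {Ω : Type*} [Field Ω] {A D : Polynomial Ω}

lemma eval_ne_zero_of_isCoprime (hAD : IsCoprime A D) {x t : Ω} (h : A.eval x = t * D.eval x) :
    D.eval x ≠ 0 := by
  intro h0
  obtain ⟨a, b, hab⟩ := hAD
  have := congrArg (Polynomial.eval x) hab
  simp [h0, h] at this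

/-- In characteristic zero, almost all fibres of a fraction `A / D` in lowest terms consist of
`max (deg A) (deg D)` points. -/
lemma eventually_card_roots [IsAlgClosed Ω] [CharZero Ω] [DecidableEq Ω] (hAD : IsCoprime A D)
    (hD : D ≠ 0) (hpos : 0 < max A.natDegree D.natDegree) :
    ∀ᶠ t in cofinite, A - C t * D ≠ 0 ∧
      (A - C t * D).roots.toFinset.card = max A.natDegree D.natDegree := by
  set N := max A.natDegree D.natDegree with hN
  -- The Wronskian of `A` and `D`. Were it zero, coprimality would give `A ∣ A'` and `D ∣ D'`, which
  -- in characteristic zero makes both constant.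
  have hW : derivative A * D - A * derivative D ≠ 0 := by
    intro h
    have h₁ : D ∣ derivative D :=
      hAD.symm.dvd_of_dvd_mul_left ⟨derivative A, by linear_combination -h⟩
    have h₂ : A ∣ derivative A := hAD.dvd_of_dvd_mul_right ⟨derivative D, by linear_combination h⟩
    rw [dvd_derivative_iff] at h₁ h₂
    have h₃ := derivative_eq_zero.mp h₁
    have h₄ := derivative_eq_zero.mp h₂
    omega
  -- As a polynomial in `t`, this is the coefficient of degree `N` in `A - t D`. Being nonzero, it
  -- vanishes for at most one `t`, and elsewhere the degree is exactly `N`.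
  have hcoeff : C (A.coeff N) - C (D.coeff N) * X ≠ 0 := by
    intro h
    have h₀ := congrArg (Polynomial.coeff · 0) h
    have h₁ := congrArg (Polynomial.coeff · 1) h
    simp at h₀ h₁
    rcases max_choice A.natDegree D.natDegree with h' | h'
    · rw [hN, h', coeff_natDegree, leadingCoeff_eq_zero] at h₀
      rw [hN, h', h₀, natDegree_zero] at hpos
      exact lt_irrefl _ hpos
    · rw [hN, h', coeff_natDegree, leadingCoeff_eq_zero] at h₁
      exact hD h₁
  -- A multiple root of `A - t D` is a zero of the Wronskian, so only the values of `A / D` at its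
  -- finitely many zeros have to be avoided.
  have hbad : ∀ᶠ t in cofinite, ∀ x, A.eval x = t * D.eval x →
      (derivative A * D - A * derivative D).eval x ≠ 0 := by
    have := eventually_eval_ne_zero hW
    rw [eventually_cofinite] at this ⊢
    refine (this.image fun x => A.eval x / D.eval x).subset fun t ht => ?_
    simp only [Set.mem_ofPred_eq, not_forall] at ht
    obtain ⟨x, hx, hx'⟩ := ht
    exact ⟨x, hx', by simp [hx, eval_ne_zero_of_isCoprime hAD hx]⟩
  filter_upwards [hbad, eventually_eval_ne_zero hcoeff] with t h₁ h₂
  have hc : (A - C t * D).coeff N ≠ 0 := by simpa [mul_comm t] using h₂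
  have h0 : A - C t * D ≠ 0 := by
    intro h; rw [h] at hc; simp at hc
  have hdeg : (A - C t * D).natDegree = N := by
    refine le_antisymm ?_ (le_natDegree_of_ne_zero hc)
    refine (natDegree_sub_le _ _).trans (max_le_max le_rfl (natDegree_C_mul_le t D))
  refine ⟨h0, ?_⟩
  rw [Multiset.toFinset_card_of_nodup, IsAlgClosed.card_roots_eq_natDegree, hdeg]
  rw [Multiset.nodup_iff_count_le_one]
  intro x
  rw [count_roots]
  by_contra! h
  obtain ⟨h₃, h₄⟩ := (one_lt_rootMultiplicity_iff_isRoot h0).mp h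
  simp only [IsRoot.def, eval_sub, eval_mul, eval_C, derivative_sub, derivative_mul, derivative_C,
    zero_mul, zero_add] at h₃ h₄
  refine h₁ x (sub_eq_zero.mp h₃) ?_
  simp only [eval_sub, eval_mul]
  linear_combination D.eval x * h₄ - (derivative D).eval x * h₃

end Fibres

/-! ### Isogenies as homomorphisms with rational coordinates: composites, sums, surjectivity. -/

variable {Ω : Type*} [Field Ω] [DecidableEq Ω] {E E₁ E₂ E₃ : WeierstrassCurve Ω}

/-- The coordinates of the homomorphism `φ` are rational functions. -/
def IsRatHom (φ : Pt E₁ →+ Pt E₂) : Prop :=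
  IsRat (fun P => xc (φ P)) ∧ IsRat (fun P => yc (φ P))

lemma GivenBy.isRatHom {φ : Pt E₁ →+ Pt E₂} {u v w : Polynomial (Polynomial Ω)}
    (h : GivenBy φ u v w) : IsRatHom φ := by
  have h' : ∀ᶠ P in cofinite, ∃ (x y : Ω) (h : E₁.toAffine.Nonsingular x y)
    (h' : E₂.toAffine.Nonsingular (u.evalEval x y / w.evalEval x y)
      (v.evalEval x y / w.evalEval x y)),
    P = .some x y h ∧ w.evalEval x y ≠ 0 ∧ φ P = .some _ _ h' := h
  constructor
  · refine ((IsRat.x.evalEval IsRat.y u).div (IsRat.x.evalEval IsRat.y w)).congr ?_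
    filter_upwards [h']
    rintro P ⟨x, y, h₁, h₂, rfl, hw, hφ⟩
    rw [hφ]; rfl
  · refine ((IsRat.x.evalEval IsRat.y v).div (IsRat.x.evalEval IsRat.y w)).congr ?_
    filter_upwards [h']
    rintro P ⟨x, y, h₁, h₂, rfl, hw, hφ⟩
    rw [hφ]; rfl

lemma IsIsogeny.isRatHom {φ : Pt E₁ →+ Pt E₂} (h : IsIsogeny Ω φ) : IsRatHom φ := by
  obtain ⟨u, v, w, h⟩ := h.rational
  exact h.isRatHom

lemma IsIsogeny.of_subfield {k : Type*} [Field k] [Algebra k Ω] {φ : Pt E₁ →+ Pt E₂}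
    (h : IsIsogeny k φ) : IsIsogeny Ω φ where
  surjective := h.surjective
  finite_ker := h.finite_ker
  rational := by
    obtain ⟨u, v, w, h⟩ := h.rational
    exact ⟨_, _, _, by simpa using h⟩

lemma IsRatHom.exists_givenBy {φ : Pt E₁ →+ Pt E₂} (h : IsRatHom φ) (hk : Finite φ.ker) :
    ∃ u v w : Polynomial (Polynomial Ω), GivenBy φ u v w := by
  obtain ⟨⟨a, b, c, hc, H⟩, ⟨a', b', c', hc', H'⟩⟩ := h
  have hev (a b c : Polynomial Ω) (x y : Ω) :
      (C (a * c) + C (b * c) * X : Polynomial (Polynomial Ω)).evalEval x y =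
        (a.eval x + b.eval x * y) * c.eval x := by
    simp only [evalEval_add, evalEval_mul, evalEval_C, evalEval_X, eval_mul]; ring
  refine ⟨C (a * c') + C (b * c') * X, C (a' * c) + C (b' * c) * X, C (c * c'), ?_⟩
  change ∀ᶠ P in cofinite, _
  filter_upwards [H, H', eventually_eval_xc_ne_zero hc, eventually_eval_xc_ne_zero hc',
    eventually_ne_pt 0, eventually_map_ne hk 0] with P h₁ h₂ h₃ h₄ h₅ h₆
  obtain ⟨x, y, h, rfl⟩ := Pt.exists_some h₅
  obtain ⟨x', y', h', he⟩ := Pt.exists_some h₆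
  simp only [he, xc_some, yc_some] at h₁ h₂ h₃ h₄
  have e₁ : (C (a * c') + C (b * c') * X : Polynomial (Polynomial Ω)).evalEval x y /
      (C (c * c') : Polynomial (Polynomial Ω)).evalEval x y = x' := by
    rw [hev, h₁, evalEval_C, eval_mul]; field_simp
  have e₂ : (C (a' * c) + C (b' * c) * X : Polynomial (Polynomial Ω)).evalEval x y /
      (C (c * c') : Polynomial (Polynomial Ω)).evalEval x y = y' := by
    rw [hev, h₂, evalEval_C, eval_mul]; field_simp
  refine ⟨x, y, h, by rw [e₁, e₂]; exact h', rfl, ?_, ?_⟩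
  · rw [evalEval_C, eval_mul]; exact mul_ne_zero h₃ h₄
  · rw [he, Affine.Point.some.injEq]; exact ⟨e₁.symm, e₂.symm⟩

lemma IsRat.comp {f : Pt E₂ → Ω} (hf : IsRat f) {φ : Pt E₁ →+ Pt E₂} (h : IsRatHom φ)
    (hk : Finite φ.ker) : IsRat (fun P => f (φ P)) := by
  obtain ⟨a, b, c, hc, H⟩ := hf
  refine (((h.1.eval a).add ((h.1.eval b).mul h.2)).div (h.1.eval c)).congr ?_
  filter_upwards [(tendsto_cofinite_of_finite_ker hk).eventually H] with P hP
  exact hP.symm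

lemma IsRatHom.comp {ψ : Pt E₂ →+ Pt E₃} {φ : Pt E₁ →+ Pt E₂} (hψ : IsRatHom ψ)
    (hφ : IsRatHom φ) (hk : Finite φ.ker) : IsRatHom (ψ.comp φ) :=
  ⟨hψ.1.comp hφ hk, hψ.2.comp hφ hk⟩

lemma finite_ker_comp {A B D : Type*} [AddCommGroup A] [AddCommGroup B] [AddCommGroup D]
    {ψ : B →+ D} {φ : A →+ B} (hψ : Finite ψ.ker) (hφ : Finite φ.ker) :
    Finite (ψ.comp φ).ker := by
  have h : ∀ᶠ a in cofinite, ψ (φ a) ≠ 0 :=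
    (tendsto_cofinite_of_finite_ker hφ).eventually (eventually_map_ne hψ 0)
  rw [eventually_cofinite] at h
  exact h.subset fun a ha => by simpa using ha

lemma IsIsogeny.comp {ψ : Pt E₂ →+ Pt E₃} {φ : Pt E₁ →+ Pt E₂} (hψ : IsIsogeny Ω ψ)
    (hφ : IsIsogeny Ω φ) : IsIsogeny Ω (ψ.comp φ) where
  surjective := hψ.surjective.comp hφ.surjective
  finite_ker := finite_ker_comp hψ.finite_ker hφ.finite_ker
  rational := by
    obtain ⟨u, v, w, h⟩ := (hψ.isRatHom.comp hφ.isRatHom hφ.finite_ker).exists_givenBy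
      (finite_ker_comp hψ.finite_ker hφ.finite_ker)
    exact ⟨u, v, w, by simpa using h⟩

lemma Pt.coord_add {P Q : Pt E} (hP : P ≠ 0) (hQ : Q ≠ 0) (h : xc P ≠ xc Q) :
    xc (P + Q) = E.toAffine.addX (xc P) (xc Q) ((yc P - yc Q) / (xc P - xc Q)) ∧
      yc (P + Q) = E.toAffine.addY (xc P) (xc Q) (yc P) ((yc P - yc Q) / (xc P - xc Q)) := by
  obtain ⟨x, y, h₁, rfl⟩ := Pt.exists_some hP
  obtain ⟨x', y', h₂, rfl⟩ := Pt.exists_some hQ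
  simp only [xc_some, yc_some] at h ⊢
  rw [Affine.Point.add_of_X_ne h, ← Affine.slope_of_X_ne (W := E.toAffine) h]
  exact ⟨rfl, rfl⟩

/-- The three conditions exclude the point at infinity and equal `x`-coordinates, so the chord
formula alone describes the sum at almost all points. -/
lemma IsRatHom.add {φ ψ : Pt E₁ →+ Pt E₂} (hφ : IsRatHom φ) (hψ : IsRatHom ψ)
    (h₁ : ∀ᶠ P in cofinite, φ P ≠ 0) (h₂ : ∀ᶠ P in cofinite, ψ P ≠ 0)
    (hne : ∀ᶠ P in cofinite, xc (φ P) ≠ xc (ψ P)) : IsRatHom (φ + ψ) := by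
  have hl := (hφ.2.sub hψ.2).div (hφ.1.sub hψ.1)
  have hX := (((hl.pow 2).add (hl.const_mul E₂.a₁)).sub (IsRat.const E₂.a₂)).sub hφ.1 |>.sub hψ.1
  have hY := ((hl.mul (hX.sub hφ.1)).add hφ.2).neg.sub (hX.const_mul E₂.a₁) |>.sub
    (IsRat.const E₂.a₃)
  constructor
  · refine hX.congr ?_
    filter_upwards [h₁, h₂, hne] with P h₃ h₄ h₅
    exact (Pt.coord_add h₃ h₄ h₅).1.symm
  · refine hY.congr ?_
    filter_upwards [h₁, h₂, hne] with P h₃ h₄ h₅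
    refine Eq.trans ?_ (Pt.coord_add h₃ h₄ h₅).2.symm
    simp only [Affine.addY, Affine.negY, Affine.negAddY, Affine.addX]

variable [IsAlgClosed Ω] [CharZero Ω] [E₁.IsElliptic] [E₂.IsElliptic]

/-- The `x`-coordinate of a rational homomorphism is a rational function of `x`. -/
lemma IsRatHom.exists_xc {φ : Pt E₁ →+ Pt E₂} (h : IsRatHom φ) :
    ∃ A D : Polynomial Ω, IsCoprime A D ∧ D ≠ 0 ∧
      ∀ᶠ P : Pt E₁ in cofinite, D.eval (xc P) ≠ 0 ∧
        xc (φ P) * D.eval (xc P) = A.eval (xc P) :=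
  h.1.exists_of_even (.of_forall fun P => by simp)

/-- The `x`-coordinate of a homomorphism with finite kernel is not constant. -/
lemma not_eventually_eq_const {φ : Pt E₁ →+ Pt E₂} (hk : Finite φ.ker) (t : Ω) :
    ¬ ∀ᶠ P in cofinite, xc (φ P) = t := by
  intro h
  obtain ⟨P, hP, hP'⟩ := (h.and ((tendsto_xc.comp (tendsto_cofinite_of_finite_ker hk)).eventually
    (Set.finite_singleton t).compl_mem_cofinite)).exists
  exact hP' hP

/-- For almost all `t`, a property of almost all points holds at all points where the fraction
`A(x) / D(x)` in lowest terms takes the value `t`. -/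
lemma eventually_forall_of_isCoprime {A D : Polynomial Ω} (hAD : IsCoprime A D)
    {p : Pt E₁ → Prop} (H : ∀ᶠ P in cofinite, p P) :
    ∀ᶠ t in cofinite, ∀ P : Pt E₁, A.eval (xc P) = t * D.eval (xc P) → p P := by
  rw [eventually_cofinite] at H ⊢
  refine (H.image fun P => A.eval (xc P) / D.eval (xc P)).subset fun t ht => ?_
  simp only [Set.mem_ofPred_eq, not_forall] at ht
  obtain ⟨P, hP, hP'⟩ := ht
  exact ⟨P, hP', by simp [hP, eval_ne_zero_of_isCoprime hAD hP]⟩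

lemma max_natDegree_pos {φ : Pt E₁ →+ Pt E₂} (hk : Finite φ.ker) {A D : Polynomial Ω}
    (H : ∀ᶠ P : Pt E₁ in cofinite, D.eval (xc P) ≠ 0 ∧
        xc (φ P) * D.eval (xc P) = A.eval (xc P)) : 0 < max A.natDegree D.natDegree := by
  rw [Nat.pos_iff_ne_zero]
  intro h
  obtain ⟨a, rfl⟩ := natDegree_eq_zero.mp (Nat.le_zero.mp (h ▸ le_max_left A.natDegree _))
  obtain ⟨e, rfl⟩ := natDegree_eq_zero.mp (Nat.le_zero.mp (h ▸ le_max_right _ D.natDegree))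
  refine not_eventually_eq_const hk (a / e) ?_
  filter_upwards [H] with P hP
  simp only [eval_C] at hP
  rw [eq_div_iff hP.1, hP.2]

/-- For almost all `Q` the equation `A(x) = x(Q) D(x)` has a root. A point `P` above that root has
`φ P = ±Q`, so `P` or `-P` maps to `Q`. The range is thus a subgroup containing almost all points.
-/
lemma IsRatHom.surjective {φ : Pt E₁ →+ Pt E₂} (h : IsRatHom φ) (hk : Finite φ.ker) :
    Function.Surjective φ := by
  obtain ⟨A, D, hAD, hD, H⟩ := h.exists_xc
  have hbad := eventually_forall_of_isCoprime hAD (H.and (eventually_map_ne hk 0))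
  rw [← AddMonoidHom.range_eq_top]
  refine addSubgroup_eq_top_of_eventually ?_
  filter_upwards [tendsto_xc.eventually hbad, tendsto_xc.eventually
    (eventually_card_roots hAD hD (max_natDegree_pos hk H)), eventually_ne_pt 0] with Q h₁ hx h₂
  obtain ⟨x, hx⟩ : ((A - C (xc Q) * D).roots.toFinset).Nonempty := by
    rw [← Finset.card_pos, hx.2]
    exact max_natDegree_pos hk H
  replace hx : A.eval x = xc Q * D.eval x := by
    have := (mem_roots'.mp (Multiset.mem_toFinset.mp hx)).2
    simpa [sub_eq_zero] using this
  obtain ⟨P, hP, rfl⟩ := exists_xc_eq (E := E₁) x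
  obtain ⟨⟨h₃, h₅⟩, h₄⟩ := h₁ P hx
  rcases Pt.eq_or_eq_neg h₄ h₂ (mul_right_cancel₀ h₃ (h₅.trans hx)) with h | h
  · exact ⟨P, h⟩
  · exact ⟨-P, by rw [map_neg, h, neg_neg]⟩

lemma IsRatHom.isIsogeny {φ : Pt E₁ →+ Pt E₂} (h : IsRatHom φ) (hk : Finite φ.ker) :
    IsIsogeny Ω φ where
  surjective := h.surjective hk
  finite_ker := hk
  rational := by
    obtain ⟨u, v, w, h⟩ := h.exists_givenBy hk
    exact ⟨u, v, w, by simpa using h⟩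

end QCurve

end

noncomputable section

namespace QCurve

open WeierstrassCurve Polynomial Filter

/-! ### Cardinalities of kernels and fibres -/

section Group

variable {A B D : Type*} [AddCommGroup A] [AddCommGroup B] [AddCommGroup D]

lemma ncard_fiber (φ : A →+ B) {b : B} (hb : ∃ a, φ a = b) :
    (φ ⁻¹' {b}).ncard = Nat.card φ.ker := by
  obtain ⟨a, rfl⟩ := hb
  have : φ ⁻¹' {φ a} = (a + ·) '' (φ.ker : Set A) := by
    ext c
    constructor
    · intro hc
      exact ⟨c - a, by simpa [AddMonoidHom.mem_ker, sub_eq_zero] using hc, by simp⟩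
    · rintro ⟨c, hc, rfl⟩
      simpa using hc
  rw [this, Set.ncard_image_of_injective _ (add_right_injective a)]
  exact (Nat.card_coe_set_eq _).symm

lemma card_ker_comp {ψ : B →+ D} {φ : A →+ B} (hφ : Function.Surjective φ) :
    Nat.card (ψ.comp φ).ker = Nat.card φ.ker * Nat.card ψ.ker := by
  let f : (ψ.comp φ).ker →+ ψ.ker := (φ.comp (ψ.comp φ).ker.subtype).codRestrict ψ.ker fun x => x.2
  have hf : Function.Surjective f := by
    rintro ⟨b, hb⟩
    obtain ⟨a, rfl⟩ := hφ b
    exact ⟨⟨a, hb⟩, rfl⟩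
  rw [← f.ker.card_mul_index, AddSubgroup.index_ker, AddMonoidHom.range_eq_top.mpr hf]
  congr 1
  · refine Nat.card_congr ⟨fun x => ⟨x.1.1, congrArg Subtype.val x.2⟩, fun x => ⟨⟨x.1, ?_⟩, ?_⟩,
      fun x => rfl, fun x => rfl⟩
    · have : φ x.1 = 0 := x.2
      simp [AddMonoidHom.mem_ker, this]
    · exact Subtype.ext x.2
  · exact Nat.card_congr AddSubgroup.topEquiv.toEquiv

lemma eventually_forall_fiber (φ : A → B) {p : A → Prop} (h : ∀ᶠ a in cofinite, p a) :
    ∀ᶠ b in cofinite, ∀ a, φ a = b → p a := by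
  rw [eventually_cofinite] at h ⊢
  refine (h.image φ).subset fun b hb => ?_
  simp only [Set.mem_ofPred_eq, not_forall] at hb
  obtain ⟨a, ha, ha'⟩ := hb
  exact ⟨a, ha', ha⟩

end Group

variable {Ω : Type*} [Field Ω] [DecidableEq Ω] {E E₁ E₂ : WeierstrassCurve Ω}

/-! ### The `x`-coordinate of a sum. -/

section Relation

/-- The relation between the `x`-coordinates of `P`, `Q` and `P + Q`. -/
lemma Pt.xc_add_relation {P Q : Pt E} (hP : P ≠ 0) (hQ : Q ≠ 0) (h : xc P ≠ xc Q) :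
    (xc P - xc Q) ^ 2 * xc (P + Q) ^ 2 - (2 * xc P * xc Q * (xc P + xc Q) + E.b₂ * (xc P * xc Q) +
      E.b₄ * (xc P + xc Q) + E.b₆) * xc (P + Q) + (xc P ^ 2 * xc Q ^ 2 - E.b₄ * (xc P * xc Q) -
        E.b₆ * (xc P + xc Q) - E.b₈) = 0 := by
  have e₁ := Pt.equation hP
  have e₂ := Pt.equation hQ
  have et := (Pt.coord_add hP hQ h).1
  have hd : xc P - xc Q ≠ 0 := sub_ne_zero.mpr h
  set l := (yc P - yc Q) / (xc P - xc Q) with hl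
  have hy : yc P = yc Q + l * (xc P - xc Q) := by rw [hl]; field_simp; ring
  set x₁ := xc P
  set x₂ := xc Q
  set t := xc (P + Q)
  rw [hy] at e₁
  set y := yc Q
  simp only [Affine.addX] at et
  clear_value l x₁ x₂ t y
  -- Substituting the chord `Y = l X + n`, with `n = y - l x₂`, into the curve gives a cubic with
  -- roots `x₁`, `x₂`, `t`. The identities `s₁`, `s₂`, `s₃` are its Vieta relations, and the last
  -- step eliminates `l` and `n` from them.
  have s₂ : x₁ * x₂ + x₁ * t + x₂ * t =
      E.a₄ - 2 * l * (y - l * x₂) - E.a₁ * (y - l * x₂) - E.a₃ * l := by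
    apply mul_left_cancel₀ hd
    linear_combination e₁ - e₂ + (x₁ ^ 2 - x₂ ^ 2) * et
  have s₃ : x₁ * x₂ * t = (y - l * x₂) ^ 2 + E.a₃ * (y - l * x₂) - E.a₆ := by
    linear_combination x₂ * s₂ - e₂ - x₂ ^ 2 * et
  simp only [b₂, b₄, b₆, b₈]
  have s₁ : x₁ + x₂ + t = l ^ 2 + E.a₁ * l - E.a₂ := by linear_combination et
  set n := y - l * x₂
  linear_combination (x₁ * x₂ + x₁ * t + x₂ * t +
      (E.a₄ - 2 * l * n - E.a₁ * n - E.a₃ * l) - (2 * E.a₄ + E.a₁ * E.a₃)) * s₂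
    - 4 * (x₁ + x₂ + t) * s₃ - 4 * (n ^ 2 + E.a₃ * n - E.a₆) * s₁ -
      (E.a₁ ^ 2 + 4 * E.a₂) * s₃ - (E.a₃ ^ 2 + 4 * E.a₆) * s₁

end Relation

/-! ### Multiplication by `n` as a rational homomorphism. -/

section Torsion

variable [IsAlgClosed Ω] [CharZero Ω] [E.IsElliptic] [E₁.IsElliptic] [E₂.IsElliptic]

lemma torsion_two_iff {P : Pt E} (hP : P ≠ 0) :
    2 • P = 0 ↔ 2 * yc P + E.a₁ * xc P + E.a₃ = 0 := by
  rw [two_nsmul, add_eq_zero_iff_eq_neg]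
  constructor
  · intro h
    have := congrArg yc h
    rw [yc_neg hP] at this
    linear_combination this
  · intro h
    refine Pt.ext_coord hP (neg_ne_zero.mpr hP) (xc_neg P).symm ?_
    rw [yc_neg hP]
    linear_combination h

lemma eval_twoTorsionPolynomial {P : Pt E} (hP : P ≠ 0) :
    E.twoTorsionPolynomial.toPoly.eval (xc P) = (2 * yc P + E.a₁ * xc P + E.a₃) ^ 2 := by
  have := Pt.equation hP
  simp only [twoTorsionPolynomial, Cubic.toPoly, eval_add, eval_mul, eval_pow, eval_X, eval_C,
    b₂, b₄, b₆]
  linear_combination -4 * this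

/-- The `x`-coordinate maps the nonzero 2-torsion points bijectively to the roots of the two-torsion
cubic, which are three distinct elements because its discriminant is nonzero. The point at infinity
is the fourth. -/
lemma card_torsion_two : Nat.card (torsion (Pt E) 2) = 4 := by
  have h4 : E.twoTorsionPolynomial.a ≠ 0 := by simp [twoTorsionPolynomial]
  have hp : E.twoTorsionPolynomial.toPoly ≠ 0 := Cubic.ne_zero_of_a_ne_zero h4
  have hcard : E.twoTorsionPolynomial.toPoly.roots.toFinset.card = 3 := by
    have := Cubic.card_roots_of_discr_ne_zero (φ := RingHom.id Ω) h4
      (IsAlgClosed.splits _) (E.twoTorsionPolynomial_discr_ne_zero_of_isElliptic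
        (isUnit_iff_ne_zero.mpr two_ne_zero))
    simpa [Cubic.map_roots] using this
  set S : Set (Pt E) := {P | P ≠ 0 ∧ 2 • P = 0}
  have himg : xc '' S = (E.twoTorsionPolynomial.toPoly.roots.toFinset : Set Ω) := by
    ext x
    simp only [Set.mem_image, Finset.mem_coe, Multiset.mem_toFinset, mem_roots hp, IsRoot.def]
    constructor
    · rintro ⟨P, ⟨hP, h2⟩, rfl⟩
      rw [eval_twoTorsionPolynomial hP, (torsion_two_iff hP).mp h2]
      simp
    · intro hx
      obtain ⟨P, hP, rfl⟩ := exists_xc_eq (E := E) x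
      rw [eval_twoTorsionPolynomial hP] at hx
      exact ⟨P, ⟨hP, (torsion_two_iff hP).mpr (pow_eq_zero_iff two_ne_zero |>.mp hx)⟩, rfl⟩
  have hinj : Set.InjOn xc S := by
    rintro P ⟨hP, h2⟩ Q ⟨hQ, h2'⟩ h
    rcases Pt.eq_or_eq_neg hP hQ h with h | h
    · exact h
    · rw [h, neg_eq_iff_add_eq_zero, ← two_nsmul, h2']
  have hS : S.ncard = 3 := by
    rw [← hinj.ncard_image, himg, Set.ncard_coe_finset, hcard]
  have hS' : S.Finite := Set.finite_of_ncard_ne_zero (by rw [hS]; decide)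
  have : ((torsion (Pt E) 2 : AddSubgroup (Pt E)) : Set (Pt E)) = insert 0 S := by
    ext P
    by_cases hP : P = 0
    · simp [hP]
    · simp [S, hP, torsion, AddMonoidHom.mem_ker]
  change Nat.card ((torsion (Pt E) 2 : AddSubgroup (Pt E)) : Set (Pt E)) = 4
  rw [Nat.card_coe_set_eq, this, Set.ncard_insert_of_notMem (by simp [S]) hS', hS]

variable (E) in
/-- Multiplication by `n`. -/
abbrev mulHom (n : ℕ) : Pt E →+ Pt E := nsmulAddMonoidHom n

lemma finite_torsion_two : Finite (mulHom E 2).ker :=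
  Nat.finite_of_card_ne_zero (by rw [show Nat.card (mulHom E 2).ker = 4 from card_torsion_two]; decide)

lemma Pt.coord_double {P : Pt E} (h : 2 • P ≠ 0) :
    xc (2 • P) = E.toAffine.addX (xc P) (xc P) ((3 * xc P ^ 2 + 2 * E.a₂ * xc P + E.a₄ -
      E.a₁ * yc P) / (2 * yc P + E.a₁ * xc P + E.a₃)) ∧
    yc (2 • P) = E.toAffine.addY (xc P) (xc P) (yc P) ((3 * xc P ^ 2 + 2 * E.a₂ * xc P + E.a₄ -
      E.a₁ * yc P) / (2 * yc P + E.a₁ * xc P + E.a₃)) := by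
  have hP : P ≠ 0 := by rintro rfl; simp at h
  have hy := mt (torsion_two_iff hP).mpr h
  obtain ⟨x, y, h₁, rfl⟩ := Pt.exists_some hP
  simp only [xc_some, yc_some] at hy ⊢
  have hy' : y ≠ E.toAffine.negY x y := fun h' => hy (by
    rw [Affine.negY] at h'; linear_combination h')
  have hs := Affine.slope_of_Y_ne (W := E.toAffine) rfl hy'
  rw [show y - E.toAffine.negY x y = 2 * y + E.a₁ * x + E.a₃ by rw [Affine.negY]; ring] at hs
  rw [two_nsmul, Affine.Point.add_self_of_Y_ne hy', ← hs]
  exact ⟨rfl, rfl⟩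

lemma isRatHom_mulHom_two : IsRatHom (mulHom E 2) := by
  have hl := ((((IsRat.x (E := E).pow 2).const_mul 3).add (IsRat.x.const_mul (2 * E.a₂))).add
    (IsRat.const E.a₄) |>.sub (IsRat.y.const_mul E.a₁)).div
      (((IsRat.y (E := E).const_mul 2).add (IsRat.x.const_mul E.a₁)).add (IsRat.const E.a₃))
  have hX := (((hl.pow 2).add (hl.const_mul E.a₁)).sub (IsRat.const E.a₂)).sub IsRat.x
    |>.sub IsRat.x
  have hY := ((hl.mul (hX.sub IsRat.x)).add IsRat.y).neg.sub (hX.const_mul E.a₁) |>.sub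
    (IsRat.const E.a₃)
  constructor
  · refine hX.congr ?_
    filter_upwards [eventually_map_ne finite_torsion_two 0] with P hP
    exact (Pt.coord_double hP).1.symm
  · refine hY.congr ?_
    filter_upwards [eventually_map_ne finite_torsion_two 0] with P hP
    refine Eq.trans ?_ (Pt.coord_double hP).2.symm
    simp only [Affine.addY, Affine.negY, Affine.negAddY, Affine.addX]

/-- No multiplication by a positive integer kills all points. -/
lemma exists_nsmul_ne_zero {n : ℕ} (hn : n ≠ 0) : ∃ P : Pt E, n • P ≠ 0 := by
  obtain ⟨T, hT, hT'⟩ : ∃ T : Pt E, T ≠ 0 ∧ 2 • T = 0 := by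
    by_contra! h
    have : torsion (Pt E) 2 = ⊥ := by
      rw [eq_bot_iff]
      intro P hP
      by_contra hP0
      exact h P hP0 hP
    have h4 := card_torsion_two (E := E)
    rw [this] at h4
    simp at h4
  have hsurj : Function.Surjective (mulHom E 2) := isRatHom_mulHom_two.surjective finite_torsion_two
  -- With `n = 2^k r` and `r` odd, take `P` with `2^k P = T`, a nonzero 2-torsion point. Then `n P =
  -- r T = T`.
  obtain ⟨k, r, hr, rfl⟩ := Nat.exists_eq_two_pow_mul_odd hn
  have hk : ∀ k : ℕ, ∃ P : Pt E, 2 ^ k • P = T := by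
    intro k
    induction k with
    | zero => exact ⟨T, by simp⟩
    | succ k ih =>
      obtain ⟨P, hP⟩ := ih
      obtain ⟨Q, rfl⟩ := hsurj P
      exact ⟨Q, by rw [pow_succ, mul_smul]; exact hP⟩
  obtain ⟨P, hP⟩ := hk k
  refine ⟨P, ?_⟩
  obtain ⟨s, rfl⟩ := hr
  rw [mul_comm, mul_smul, hP, add_smul, mul_comm, mul_smul, hT', smul_zero, one_smul, zero_add]
  exact hT

lemma mulHom_ne_zero {n : ℕ} (hn : n ≠ 0) : mulHom E n ≠ 0 := fun h => by
  obtain ⟨P, hP⟩ := exists_nsmul_ne_zero (E := E) hn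
  exact hP (DFunLike.congr_fun h P)

/-- If equality held infinitely often it would hold almost everywhere, as both sides are rational.
Then `nP = ±P`, so `(n + 1)(n - 1)` would kill almost all points, hence all. This makes the chord
formula applicable to `nP ± P`. -/
lemma eventually_xc_nsmul_ne {n : ℕ} (hn : 2 ≤ n) (h : IsRatHom (mulHom E n))
    (hk : Finite (mulHom E n).ker) : ∀ᶠ P : Pt E in cofinite, xc (n • P) ≠ xc P := by
  rcases (h.1.sub IsRat.x).eventually_zero_or_ne_zero with h0 | h0
  · exfalso
    refine mulHom_ne_zero (E := E) (n := (n + 1) * (n - 1)) ?_ ?_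
    · exact mul_ne_zero (by omega) (by omega)
    · refine addMonoidHom_eq_of_eventuallyEq ?_
      filter_upwards [h0, eventually_map_ne hk 0, eventually_ne_pt 0] with P h₁ h₂ h₃
      change ((n + 1) * (n - 1)) • P = 0
      rcases Pt.eq_or_eq_neg h₂ h₃ (sub_eq_zero.mp h₁) with h | h
      · have : (n - 1) • P = 0 := by
          have h' : n • P = P := h
          obtain ⟨k, rfl⟩ := Nat.exists_eq_add_of_le' (show 1 ≤ n by omega)
          simpa [add_smul] using h'
        rw [mul_smul, this, smul_zero]
      · have : (n + 1) • P = 0 := by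
          have h' : n • P = -P := h
          rw [add_smul, h', one_smul, neg_add_cancel]
        rw [mul_comm, mul_smul, this, smul_zero]
  · filter_upwards [h0] with P hP h
    exact hP (sub_eq_zero.mpr h)

/-- Induction through `(n + 1)P = nP + P`. A point of the new kernel satisfies `nP = -P`, hence
`x(nP) = x(P)`, which happens only finitely often. -/
lemma isRatHom_mulHom {n : ℕ} (hn : n ≠ 0) :
    IsRatHom (mulHom E n) ∧ Finite (mulHom E n).ker := by
  have h1 : mulHom E 1 = AddMonoidHom.id _ := by ext P; simp
  rcases Nat.lt_or_ge n 2 with h | h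
  · obtain rfl : n = 1 := by omega
    rw [h1]
    refine ⟨⟨IsRat.x, IsRat.y⟩, ?_⟩
    rw [show (AddMonoidHom.id (Pt E)).ker = ⊥ from AddMonoidHom.ker_id]
    infer_instance
  · induction n, h using Nat.le_induction with
    | base => exact ⟨isRatHom_mulHom_two, finite_torsion_two⟩
    | succ n hn2 ih =>
      obtain ⟨h, hk⟩ := ih (by omega)
      have hne := eventually_xc_nsmul_ne hn2 h hk
      have hadd : mulHom E (n + 1) = mulHom E n + AddMonoidHom.id _ := by
        ext P; simp [add_smul]
      constructor
      · rw [hadd]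
        exact h.add ⟨IsRat.x, IsRat.y⟩ (eventually_map_ne hk 0) (eventually_ne_pt 0) hne
      · rw [eventually_cofinite] at hne
        refine hne.subset fun P hP => ?_
        have h' : n • P = -P := by
          rw [eq_neg_iff_add_eq_zero]
          simpa [add_smul] using hP
        simp [h']

lemma nsmul_surjective {n : ℕ} (hn : n ≠ 0) : Function.Surjective (mulHom E n) :=
  (isRatHom_mulHom hn).1.surjective (isRatHom_mulHom hn).2

/-- The degree in `x` of the `x`-coordinate of an isogeny is at most the order of the kernel. -/
lemma max_natDegree_le_card_ker {φ : Pt E₁ →+ Pt E₂} (h : IsRatHom φ) (hk : Finite φ.ker)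
    {A D : Polynomial Ω} (hAD : IsCoprime A D) (hD : D ≠ 0)
    (H : ∀ᶠ P : Pt E₁ in cofinite, D.eval (xc P) ≠ 0 ∧
        xc (φ P) * D.eval (xc P) = A.eval (xc P)) :
    max A.natDegree D.natDegree ≤ Nat.card φ.ker := by
  have hbad := eventually_forall_of_isCoprime hAD (H.and (eventually_map_ne hk 0))
  obtain ⟨Q, h₁, hcard, hQ⟩ := ((tendsto_xc.eventually hbad).and ((tendsto_xc.eventually
    (eventually_card_roots hAD hD (max_natDegree_pos hk H))).and
      (eventually_ne_pt (0 : Pt E₂)))).exists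
  rw [← hcard.2, ← ncard_fiber φ (h.surjective hk Q), ← Set.ncard_coe_finset]
  have hfin : (φ ⁻¹' {Q}).Finite :=
    (tendsto_cofinite_of_finite_ker hk).eventually
      (Set.finite_singleton Q).compl_mem_cofinite |>.subset fun a ha => by simpa using ha
  -- For generic `Q`, each root of `A - x(Q) D` is the `x`-coordinate of a point in the fibre over
  -- `Q`, obtained by a choice of sign. The fibre has as many points as the kernel.
  refine le_trans (Set.ncard_le_ncard ?_ (hfin.image xc)) (Set.ncard_image_le hfin)
  intro x hx
  replace hx : A.eval x = xc Q * D.eval x := by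
    have := (mem_roots'.mp (Multiset.mem_toFinset.mp hx)).2
    simpa [sub_eq_zero] using this
  obtain ⟨P, hP, rfl⟩ := exists_xc_eq (E := E₁) x
  obtain ⟨⟨h₃, h₅⟩, h₄⟩ := h₁ P hx
  rcases Pt.eq_or_eq_neg h₄ hQ (mul_right_cancel₀ h₃ (h₅.trans hx)) with h | h
  · exact ⟨P, h, rfl⟩
  · exact ⟨-P, by simp [h], xc_neg P⟩

end Torsion

end QCurve

end

/-! ### The order of the `n`-torsion. -/

noncomputable section

namespace QCurve

open WeierstrassCurve Polynomial Filter

variable {Ω : Type*} [Field Ω] [DecidableEq Ω] {E E₁ E₂ : WeierstrassCurve Ω}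
variable [IsAlgClosed Ω] [CharZero Ω] [E.IsElliptic] [E₁.IsElliptic] [E₂.IsElliptic]

/-- The numerator of the relation between the `x`-coordinates of `nP`, `P` and `nP ± P`, where
`x(nP) = A(x) / D(x)` and `t = x(nP ± P)`. -/
def addRelation (E : WeierstrassCurve Ω) (A D : Polynomial Ω) (t : Ω) : Polynomial Ω :=
  C (t ^ 2) * ((A - X * D) * (A - X * D)) - C t * (C 2 * ((A * X) * (A + X * D)) +
    C E.b₂ * ((A * X) * D) + C E.b₄ * ((A + X * D) * D) + C E.b₆ * (D * D)) +
    ((A * X) * (A * X) - C E.b₄ * ((A * X) * D) - C E.b₆ * ((A + X * D) * D) - C E.b₈ * (D * D))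

lemma eval_addRelation (A D : Polynomial Ω) (s t x : Ω) (h : s * D.eval x = A.eval x) :
    (addRelation E A D t).eval x = D.eval x ^ 2 * ((s - x) ^ 2 * t ^ 2 -
      (2 * s * x * (s + x) + E.b₂ * (s * x) + E.b₄ * (s + x) + E.b₆) * t +
      (s ^ 2 * x ^ 2 - E.b₄ * (s * x) - E.b₆ * (s + x) - E.b₈)) := by
  simp only [addRelation, eval_add, eval_sub, eval_mul, eval_C, eval_X, ← h]
  ring

lemma natDegree_addRelation_le (A D : Polynomial Ω) (t : Ω) :
    (addRelation E A D t).natDegree ≤ 2 * max A.natDegree D.natDegree + 2 := by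
  set N := max A.natDegree D.natDegree
  have hA : A.natDegree ≤ N := le_max_left _ _
  have hD : D.natDegree ≤ N := le_max_right _ _
  have hX : (X : Polynomial Ω).natDegree ≤ 1 := natDegree_X_le
  have hAX : (A * X).natDegree ≤ N + 1 := natDegree_mul_le.trans (by omega)
  have hXD : (X * D).natDegree ≤ N + 1 := natDegree_mul_le.trans (by omega)
  have hs : (A + X * D).natDegree ≤ N + 1 := (natDegree_add_le _ _).trans (by omega)
  have hd : (A - X * D).natDegree ≤ N + 1 := (natDegree_sub_le _ _).trans (by omega)
  have hm {p q : Polynomial Ω} (hp : p.natDegree ≤ N + 1) (hq : q.natDegree ≤ N + 1) :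
      (p * q).natDegree ≤ 2 * N + 2 := natDegree_mul_le.trans (by omega)
  have hc {p : Polynomial Ω} (t : Ω) (hp : p.natDegree ≤ 2 * N + 2) :
      (C t * p).natDegree ≤ 2 * N + 2 := (natDegree_C_mul_le t p).trans hp
  have ha {p q : Polynomial Ω} (hp : p.natDegree ≤ 2 * N + 2) (hq : q.natDegree ≤ 2 * N + 2) :
      (p + q).natDegree ≤ 2 * N + 2 := (natDegree_add_le _ _).trans (max_le hp hq)
  have hb {p q : Polynomial Ω} (hp : p.natDegree ≤ 2 * N + 2) (hq : q.natDegree ≤ 2 * N + 2) :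
      (p - q).natDegree ≤ 2 * N + 2 := (natDegree_sub_le _ _).trans (max_le hp hq)
  have hD' : D.natDegree ≤ N + 1 := by omega
  exact ha (hb (hc _ (hm hd hd)) (hc _ (ha (ha (ha (hc _ (hm hAX hs)) (hc _ (hm hAX hD')))
    (hc _ (hm hs hD'))) (hc _ (hm hD' hD'))))) (hb (hb (hb (hm hAX hAX) (hc _ (hm hAX hD')))
      (hc _ (hm hs hD'))) (hc _ (hm hD' hD')))

/-- Evaluated at the fixed `x` and divided by `D(x)²`, the relation is a polynomial in `t` whose
coefficient of `t²` is `(s - x)² ≠ 0`. -/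
lemma eventually_addRelation_ne_zero {A D : Polynomial Ω} {s x : Ω} (h : s * D.eval x = A.eval x)
    (hD : D.eval x ≠ 0) (hne : s ≠ x) : ∀ᶠ t in cofinite, addRelation E A D t ≠ 0 := by
  set p : Polynomial Ω := C ((s - x) ^ 2) * X ^ 2 -
      C (2 * s * x * (s + x) + E.b₂ * (s * x) + E.b₄ * (s + x) + E.b₆) * X +
      C (s ^ 2 * x ^ 2 - E.b₄ * (s * x) - E.b₆ * (s + x) - E.b₈) with hp
  have hp0 : p ≠ 0 := by
    intro h0
    have h2 : p.coeff 2 = (s - x) ^ 2 := by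
      simp only [hp, coeff_add, coeff_sub, coeff_C_mul, coeff_X_pow, coeff_X, coeff_C]
      norm_num
    rw [h0, coeff_zero] at h2
    exact pow_ne_zero 2 (sub_ne_zero.mpr hne) h2.symm
  filter_upwards [eventually_eval_ne_zero hp0] with t ht h0
  have := eval_addRelation (E := E) A D s t x h
  rw [h0, eval_zero] at this
  refine ht ?_
  have h' := (mul_eq_zero.mp this.symm).resolve_left (pow_ne_zero 2 hD)
  simp only [hp, eval_add, eval_sub, eval_mul, eval_pow, eval_C, eval_X]
  linear_combination h'

/-- For generic `Q`, the solutions of `nP + P = Q` and of `nP - P = Q` number `|E[n + 1]|` and `|E[n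
- 1]|`. Their `x`-coordinates are pairwise distinct roots of `addRelation` at `t = x(Q)`, whose
degree is at most `2N + 2`, where `N ≤ |E[n]|` is the degree of `x(nP)` in `x`. -/
lemma card_torsion_add_le {n : ℕ} (hn : 2 ≤ n) :
    Nat.card (torsion (Pt E) (n + 1)) + Nat.card (torsion (Pt E) (n - 1)) ≤
      2 * Nat.card (torsion (Pt E) n) + 2 := by
  obtain ⟨h, hk⟩ := isRatHom_mulHom (E := E) (n := n) (by omega)
  obtain ⟨A, D, hAD, hD, H⟩ := h.exists_xc
  have hN : max A.natDegree D.natDegree ≤ Nat.card (torsion (Pt E) n) :=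
    max_natDegree_le_card_ker h hk hAD hD H
  have hne := eventually_xc_nsmul_ne hn h hk
  -- Genericity conditions on the solutions `P`: `2P ≠ 0` makes the two fibres disjoint, and `2nP ≠
  -- 0` excludes `P` in the first with `-P` in the second. The condition `2Q ≠ 0`, imposed below,
  -- excludes `P` and `-P` in the same fibre.
  have hgood : ∀ᶠ P : Pt E in cofinite, P ≠ 0 ∧ n • P ≠ 0 ∧ xc (n • P) ≠ xc P ∧
      (2 * n) • P ≠ 0 ∧ 2 • P ≠ 0 ∧ D.eval (xc P) ≠ 0 ∧
        xc (n • P) * D.eval (xc P) = A.eval (xc P) :=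
    (eventually_ne_pt 0).and ((eventually_map_ne hk 0).and (hne.and
      ((eventually_map_ne (isRatHom_mulHom (n := 2 * n) (by omega)).2 0).and
        ((eventually_map_ne finite_torsion_two 0).and H))))
  obtain ⟨P₀, hP₀⟩ := hgood.exists
  have hG := eventually_addRelation_ne_zero (E := E) hP₀.2.2.2.2.2.2 hP₀.2.2.2.2.2.1 hP₀.2.2.1
  obtain ⟨Q, hQ₁, hQ₂, hQ₃, hQ₄⟩ := ((eventually_forall_fiber (mulHom E (n + 1)) hgood).and
    ((eventually_forall_fiber (mulHom E (n - 1)) hgood).and ((tendsto_xc.eventually hG).and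
      (eventually_map_ne (finite_torsion_two (E := E)) 0)))).exists
  replace hQ₄ : 2 • Q ≠ 0 := hQ₄
  have hfib (k : ℕ) (hk : k ≠ 0) : (mulHom E k ⁻¹' {Q}).ncard = Nat.card (torsion (Pt E) k) ∧
      (mulHom E k ⁻¹' {Q}).Finite := by
    have := ncard_fiber (mulHom E k) (nsmul_surjective hk Q)
    refine ⟨this, Set.finite_of_ncard_ne_zero ?_⟩
    rw [this]
    have := (isRatHom_mulHom (E := E) hk).2
    exact Nat.card_pos.ne'
  obtain ⟨c₁, f₁⟩ := hfib (n + 1) (by omega)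
  obtain ⟨c₂, f₂⟩ := hfib (n - 1) (by omega)
  set F₁ := mulHom E (n + 1) ⁻¹' {Q}
  set F₂ := mulHom E (n - 1) ⁻¹' {Q}
  have m₁ {P : Pt E} (hP : P ∈ F₁) : n • P + P = Q := by
    have : (n + 1) • P = Q := hP
    rwa [add_smul, one_smul] at this
  have m₂ {P : Pt E} (hP : P ∈ F₂) : n • P - P = Q := by
    have : (n - 1) • P = Q := hP
    obtain ⟨k, rfl⟩ := Nat.exists_eq_add_of_le' (show 1 ≤ n by omega)
    simpa [add_smul] using this
  have hdisj : Disjoint F₁ F₂ := by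
    rw [Set.disjoint_left]
    intro P h₁ h₂
    refine (hQ₁ P h₁).2.2.2.2.1 ?_
    have := (m₁ h₁).trans (m₂ h₂).symm
    rw [sub_eq_add_neg, add_left_cancel_iff, eq_neg_iff_add_eq_zero, ← two_nsmul] at this
    exact this
  have hgoodP {P : Pt E} (hP : P ∈ F₁ ∪ F₂) := hP.elim (hQ₁ P) (hQ₂ P)
  have hcross {P : Pt E} (h₁ : P ∈ F₁) (h₂ : -P ∈ F₂) : False := by
    refine (hQ₁ P h₁).2.2.2.1 ?_
    have := (m₁ h₁).trans (m₂ h₂).symm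
    rw [smul_neg, sub_neg_eq_add, add_right_cancel_iff, eq_neg_iff_add_eq_zero, ← two_nsmul,
      ← mul_smul] at this
    exact this
  have hinj : Set.InjOn xc (F₁ ∪ F₂) := by
    intro P hP P' hP' hx
    rcases Pt.eq_or_eq_neg (hgoodP hP).1 (hgoodP hP').1 hx with h | rfl
    · exact h
    · exfalso
      rcases hP with hP | hP <;> rcases hP' with hP' | hP'
      · refine hQ₄ ?_
        have h₁ := m₁ hP
        have h₂ := m₁ hP'
        rw [smul_neg, ← neg_add, h₂] at h₁
        rw [two_nsmul, ← neg_eq_iff_add_eq_zero, h₁]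
      · exact hcross hP (by rwa [neg_neg])
      · exact hcross hP' hP
      · refine hQ₄ ?_
        have h₁ := m₂ hP
        have h₂ := m₂ hP'
        rw [smul_neg, ← neg_sub', h₂] at h₁
        rw [two_nsmul, ← neg_eq_iff_add_eq_zero, h₁]
  have hsub : xc '' (F₁ ∪ F₂) ⊆ ((addRelation E A D (xc Q)).roots.toFinset : Set Ω) := by
    rintro _ ⟨P, hP, rfl⟩
    obtain ⟨g₁, g₂, g₃, -, -, g₄, g₅⟩ := hgoodP hP
    rw [Finset.mem_coe, Multiset.mem_toFinset, mem_roots hQ₃, IsRoot.def,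
      eval_addRelation A D _ _ _ g₅]
    rcases hP with hP | hP
    · have := Pt.xc_add_relation g₂ g₁ g₃
      rw [m₁ hP] at this
      rw [this, mul_zero]
    · have := Pt.xc_add_relation g₂ (neg_ne_zero.mpr g₁) (by rwa [xc_neg])
      rw [← sub_eq_add_neg, m₂ hP, xc_neg] at this
      rw [this, mul_zero]
  have := Set.ncard_le_ncard hsub (Finset.finite_toSet _)
  rw [hinj.ncard_image, Set.ncard_union_eq hdisj f₁ f₂, c₁, c₂,
    Set.ncard_coe_finset] at this
  have h₁ := Multiset.toFinset_card_le (addRelation E A D (xc Q)).roots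
  have h₂ := card_roots' (addRelation E A D (xc Q))
  have h₃ := natDegree_addRelation_le (E := E) A D (xc Q)
  omega

lemma card_torsion_two_pow (k : ℕ) : Nat.card (torsion (Pt E) (2 ^ k)) = 4 ^ k := by
  induction k with
  | zero =>
    have : torsion (Pt E) (2 ^ 0) = ⊥ := by
      ext P; simp [torsion, AddMonoidHom.mem_ker]
    rw [this]; simp
  | succ k ih =>
    have : torsion (Pt E) (2 ^ (k + 1)) = ((mulHom E (2 ^ k)).comp (mulHom E 2)).ker := by
      ext P
      simp [torsion, AddMonoidHom.mem_ker, pow_succ, mul_smul]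
    rw [this, card_ker_comp (φ := mulHom E 2) (nsmul_surjective two_ne_zero), pow_succ, mul_comm]
    exact congrArg₂ _ ih card_torsion_two

/-- Over an algebraically closed field of characteristic zero, `E[n]` has order `n²`. -/
lemma card_torsion {n : ℕ} (hn : n ≠ 0) : Nat.card (torsion (Pt E) n) = n ^ 2 := by
  -- Since `n²` has second difference 2, `card_torsion_add_le` makes `e` convex. As `e 1 = e 2 = 0`,
  -- it is nondecreasing from 1 on. It also vanishes at powers of 2, so `0 = e 1 ≤ e n ≤ e (2 ^ n) =
  -- 0`.
  set e : ℕ → ℤ := fun n => n ^ 2 - Nat.card (torsion (Pt E) n) with he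
  have h1 : e 1 = 0 := by
    have := card_torsion_two_pow (E := E) 0
    simp only [pow_zero] at this
    simp [he, this]
  have h2 : e 2 = 0 := by
    simp [he, card_torsion_two (E := E)]
  have hconv (n : ℕ) (hn : 1 ≤ n) : e n ≤ e (n + 1) := by
    suffices h : e n ≤ e (n + 1) ∧ e (n + 1) - e n ≤ e (n + 2) - e (n + 1) from h.1
    have step (n : ℕ) (hn : 1 ≤ n) : e (n + 1) - e n ≤ e (n + 2) - e (n + 1) := by
      have := card_torsion_add_le (E := E) (n := n + 1) (by omega)
      rw [Nat.add_sub_cancel] at this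
      simp only [he]
      push_cast
      have h' : (Nat.card (torsion (Pt E) (n + 2)) : ℤ) + Nat.card (torsion (Pt E) n) ≤
        2 * Nat.card (torsion (Pt E) (n + 1)) + 2 := by exact_mod_cast this
      linarith
    refine ⟨?_, step n hn⟩
    induction n, hn using Nat.le_induction with
    | base => rw [h1, h2]
    | succ n hn ih => linarith [step n hn]
  have hmono {a b : ℕ} (ha : 1 ≤ a) (hab : a ≤ b) : e a ≤ e b := by
    induction b, hab using Nat.le_induction with
    | base => rfl
    | succ b hb ih => exact ih.trans (hconv b (ha.trans hb))
  have hpow : e (2 ^ n) = 0 := by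
    simp only [he, card_torsion_two_pow]
    push_cast
    rw [← pow_mul, mul_comm, pow_mul]
    norm_num
  have h₁ := hmono le_rfl (Nat.one_le_iff_ne_zero.mpr hn)
  have h₂ := hmono (Nat.one_le_iff_ne_zero.mpr hn) Nat.lt_two_pow_self.le
  rw [h1] at h₁
  rw [hpow] at h₂
  have : e n = 0 := le_antisymm h₂ h₁
  simp only [he] at this
  exact_mod_cast (sub_eq_zero.mp this).symm

end QCurve

end

noncomputable section

namespace QCurve

open WeierstrassCurve Polynomial Filter

/-! ### Functions that factor through an isogeny -/

section Factor

variable {Ω : Type*} [Field Ω]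

/-- The polynomial `D ^ k * H(A / D)`, where `H` has degree at most `k`. -/
def homogenize (A D H : Polynomial Ω) (k : ℕ) : Polynomial Ω :=
  ∑ i ∈ Finset.range (k + 1), C (H.coeff i) * (A ^ i * D ^ (k - i))

lemma eval_homogenize {A D H : Polynomial Ω} {k : ℕ} (hH : H.natDegree < k + 1) {x t : Ω}
    (h : A.eval x = t * D.eval x) :
    (homogenize A D H k).eval x = D.eval x ^ k * H.eval t := by
  rw [homogenize, eval_finsetSum, eval_eq_sum_range' hH, Finset.mul_sum]
  refine Finset.sum_congr rfl fun i hi => ?_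
  have hi' : i ≤ k := Nat.lt_succ_iff.mp (Finset.mem_range.mp hi)
  simp only [eval_mul, eval_C, eval_pow, h, mul_pow]
  rw [← Nat.add_sub_cancel' hi', pow_add, Nat.add_sub_cancel_left]
  ring

lemma natDegree_homogenize_le (A D H : Polynomial Ω) (k : ℕ) :
    (homogenize A D H k).natDegree ≤ k * max A.natDegree D.natDegree := by
  refine natDegree_sum_le_of_forall_le _ _ fun i hi => ?_
  have hi' : i ≤ k := Nat.lt_succ_iff.mp (Finset.mem_range.mp hi)
  refine (natDegree_C_mul_le _ _).trans (natDegree_mul_le.trans ?_)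
  calc _ ≤ i * max A.natDegree D.natDegree + (k - i) * max A.natDegree D.natDegree :=
        add_le_add (natDegree_pow_le.trans (Nat.mul_le_mul_left _ (le_max_left _ _)))
          (natDegree_pow_le.trans (Nat.mul_le_mul_left _ (le_max_right _ _)))
    _ = _ := by rw [← add_mul, Nat.add_sub_cancel' hi']

/-- There are always polynomials `H₁`, `H₂` of degree at most `k`, not both zero, such that the
fraction `H₁ / H₂` takes `2 * k + 1` prescribed values. -/
lemma exists_interpolation (k : ℕ) (T : Finset Ω) (hT : T.card ≤ 2 * k + 1) (v : Ω → Ω) :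
    ∃ H₁ H₂ : Polynomial Ω, (H₁ ≠ 0 ∨ H₂ ≠ 0) ∧ H₁.natDegree < k + 1 ∧ H₂.natDegree < k + 1 ∧
      ∀ t ∈ T, H₁.eval t = v t * H₂.eval t := by
  let V := degreeLT Ω (k + 1)
  let L : V × V →ₗ[Ω] (T → Ω) :=
    LinearMap.pi fun t => (leval (t : Ω) ∘ₗ V.subtype) ∘ₗ LinearMap.fst Ω V V -
      v t • ((leval (t : Ω) ∘ₗ V.subtype) ∘ₗ LinearMap.snd Ω V V)
  have hfin : Module.Finite Ω V := Module.Finite.equiv (degreeLTEquiv Ω (k + 1)).symm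
  have hV : Module.finrank Ω V = k + 1 := by
    rw [(degreeLTEquiv Ω (k + 1)).finrank_eq, Module.finrank_fin_fun]
  -- There are `2(k + 1)` unknown coefficients and at most `2k + 1` linear conditions.
  have hlt : Module.finrank Ω (T → Ω) < Module.finrank Ω (V × V) := by
    rw [Module.finrank_prod, hV, Module.finrank_fintype_fun_eq_card, Fintype.card_coe]
    omega
  obtain ⟨⟨H₁, H₂⟩, hL, hne⟩ := Submodule.exists_mem_ne_zero_of_ne_bot
    (LinearMap.ker_ne_bot_of_finrank_lt (f := L) hlt)
  have hdeg (H : V) : (H : Polynomial Ω).natDegree < k + 1 := by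
    by_cases h0 : (H : Polynomial Ω) = 0
    · rw [h0, natDegree_zero]; omega
    · exact (natDegree_lt_iff_degree_lt h0).mpr (mem_degreeLT.mp H.2)
  refine ⟨H₁, H₂, ?_, hdeg H₁, hdeg H₂, fun t ht => ?_⟩
  · by_contra! h
    exact hne (Prod.ext (Subtype.ext h.1) (Subtype.ext h.2))
  · have := congrFun (LinearMap.mem_ker.mp hL) ⟨t, ht⟩
    exact sub_eq_zero.mp this

variable [IsAlgClosed Ω] [CharZero Ω]

/-- If the fraction `p / r` is constant on almost all fibres of the fraction `A / D` in lowest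
terms, then it is a rational function of `A / D`. -/
lemma exists_factor {A D p r : Polynomial Ω} (hAD : IsCoprime A D) (hD : D ≠ 0)
    (hpos : 0 < max A.natDegree D.natDegree)
    (H : ∀ᶠ t in cofinite, ∃ v, ∀ x, A.eval x = t * D.eval x →
      r.eval x ≠ 0 ∧ p.eval x = v * r.eval x) :
    ∃ H₁ H₂ : Polynomial Ω, H₂ ≠ 0 ∧ ∀ x t, A.eval x = t * D.eval x →
      r.eval x * H₁.eval t = p.eval x * H₂.eval t := by
  classical
  have hgood := (eventually_card_roots hAD hD hpos).and H
  have hroot {t x : Ω} (hx : x ∈ (A - C t * D).roots.toFinset) : A.eval x = t * D.eval x := by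
    have := (mem_roots'.mp (Multiset.mem_toFinset.mp hx)).2
    simpa [sub_eq_zero] using this
  set N := max A.natDegree D.natDegree
  set k := max p.natDegree r.natDegree
  have : Infinite Ω := IsAlgClosed.instInfinite
  have hinf : {t : Ω | (A - C t * D ≠ 0 ∧ (A - C t * D).roots.toFinset.card = N) ∧
      ∃ v, ∀ x, A.eval x = t * D.eval x → r.eval x ≠ 0 ∧ p.eval x = v * r.eval x}.Infinite := by
    intro hfin
    obtain ⟨t, ht, ht'⟩ := (hgood.and hfin.compl_mem_cofinite).exists
    exact ht' ht
  obtain ⟨T, hTsub, hTcard⟩ := hinf.exists_subset_card_eq (2 * k + 1)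
  have hTv : ∀ t : Ω, ∃ v, t ∈ T → ∀ x, A.eval x = t * D.eval x →
      r.eval x ≠ 0 ∧ p.eval x = v * r.eval x := by
    intro t
    by_cases ht : t ∈ T
    · obtain ⟨v, hv⟩ := (hTsub ht).2
      exact ⟨v, fun _ => hv⟩
    · exact ⟨0, fun h => absurd h ht⟩
  choose v hv using hTv
  obtain ⟨H₁, H₂, hne, hd₁, hd₂, hH⟩ := exists_interpolation k T hTcard.le v
  -- The degree is at most `k + kN`, but the polynomial vanishes on `2k + 1` disjoint fibres of `N`
  -- points each. Since `N > 0`, `(2k + 1)N > k + kN`.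
  have hZ : r * homogenize A D H₁ k - p * homogenize A D H₂ k = 0 := by
    by_contra hZ
    have hsub : T.biUnion (fun t => (A - C t * D).roots.toFinset) ⊆
        (r * homogenize A D H₁ k - p * homogenize A D H₂ k).roots.toFinset := by
      intro x hx
      obtain ⟨t, ht, hx⟩ := Finset.mem_biUnion.mp hx
      have hx' := hroot hx
      rw [Multiset.mem_toFinset, mem_roots hZ, IsRoot.def, eval_sub, eval_mul, eval_mul,
        eval_homogenize hd₁ hx', eval_homogenize hd₂ hx', hH t ht, (hv t ht x hx').2]
      ring
    have hcard := Finset.card_le_card hsub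
    rw [Finset.card_biUnion, Finset.sum_congr rfl fun t ht => (hTsub ht).1.2, Finset.sum_const,
      hTcard, smul_eq_mul] at hcard
    · have h₁ := Multiset.toFinset_card_le
        (r * homogenize A D H₁ k - p * homogenize A D H₂ k).roots
      have h₂ := card_roots' (r * homogenize A D H₁ k - p * homogenize A D H₂ k)
      have h₃ : (r * homogenize A D H₁ k - p * homogenize A D H₂ k).natDegree ≤ k + k * N := by
        refine (natDegree_sub_le _ _).trans (max_le ?_ ?_)
        · exact natDegree_mul_le.trans
            (add_le_add (le_max_right _ _) (natDegree_homogenize_le _ _ _ _))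
        · exact natDegree_mul_le.trans
            (add_le_add (le_max_left _ _) (natDegree_homogenize_le _ _ _ _))
      nlinarith
    · intro t ht t' ht' htt'
      rw [Function.onFun, Finset.disjoint_left]
      intro x hx hx'
      have e₁ := hroot hx
      exact htt' (mul_right_cancel₀ (eval_ne_zero_of_isCoprime hAD e₁) (e₁.symm.trans (hroot hx')))
  have key (x t : Ω) (hx : A.eval x = t * D.eval x) :
      r.eval x * H₁.eval t = p.eval x * H₂.eval t := by
    have := congrArg (Polynomial.eval x) hZ
    rw [eval_sub, eval_mul, eval_mul, eval_homogenize hd₁ hx, eval_homogenize hd₂ hx,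
      eval_zero] at this
    apply mul_left_cancel₀ (pow_ne_zero k (eval_ne_zero_of_isCoprime hAD hx))
    linear_combination this
  refine ⟨H₁, H₂, ?_, key⟩
  rintro rfl
  have hH₁ : H₁ ≠ 0 := by simpa using hne
  obtain ⟨t, ⟨⟨-, hc⟩, w, hw⟩, ht⟩ := (hgood.and (eventually_eval_ne_zero hH₁)).exists
  obtain ⟨x, hx⟩ : ((A - C t * D).roots.toFinset).Nonempty := by
    rw [← Finset.card_pos, hc]; exact hpos
  have := key x t (hroot hx)
  rw [eval_zero, mul_zero] at this
  exact mul_ne_zero (hw x (hroot hx)).1 ht this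

variable [DecidableEq Ω] {E₁ E₂ : WeierstrassCurve Ω} [E₁.IsElliptic] [E₂.IsElliptic]

/-- The pullback is even, hence a fraction in `x(P)`. It is constant on generic fibres of `x ∘ φ`,
because `x(φ P)` determines `φ P` up to a sign that `h` ignores. So `exists_factor` writes it as a
fraction in `x(φ P)`. -/
lemma IsRat.of_comp_of_even {φ : Pt E₁ →+ Pt E₂} (hφ : IsIsogeny Ω φ) {h : Pt E₂ → Ω}
    (he : ∀ Q, h (-Q) = h Q) (hr : IsRat fun P => h (φ P)) : IsRat h := by
  obtain ⟨A, D, hAD, hD, H⟩ := hφ.isRatHom.exists_xc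
  obtain ⟨p, r, -, -, H'⟩ := hr.exists_of_even (.of_forall fun P => by rw [map_neg, he])
  have hgood := H.and ((eventually_map_ne hφ.finite_ker 0).and H')
  obtain ⟨H₁, H₂, hH₂, key⟩ := exists_factor (p := p) (r := r) hAD hD
    (max_natDegree_pos hφ.finite_ker H) (by
      filter_upwards [eventually_forall_of_isCoprime hAD hgood] with t ht
      obtain ⟨Q, hQ, rfl⟩ := exists_xc_eq (E := E₂) t
      refine ⟨h Q, fun x hx => ?_⟩
      obtain ⟨P, hP, rfl⟩ := exists_xc_eq (E := E₁) x
      obtain ⟨⟨g₁, g₂⟩, g₃, g₄, g₅⟩ := ht P hx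
      refine ⟨g₄, ?_⟩
      rcases Pt.eq_or_eq_neg g₃ hQ (mul_right_cancel₀ g₁ (g₂.trans hx)) with e | e
      · rw [← e, g₅]
      · rw [← g₅, e, he])
  refine ⟨H₁, 0, H₂, hH₂, ?_⟩
  filter_upwards [eventually_forall_fiber φ hgood, eventually_eval_xc_ne_zero hH₂] with Q hQ hQ'
  obtain ⟨P, rfl⟩ := hφ.surjective Q
  obtain ⟨⟨g₁, g₂⟩, g₃, g₄, g₅⟩ := hQ P rfl
  have := key _ _ g₂.symm
  rw [eval_zero, zero_mul, add_zero, eq_div_iff hQ']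
  apply mul_left_cancel₀ g₄
  linear_combination -this + H₂.eval (xc (φ P)) * g₅

/-- A function on `E₂` is rational if its pullback under an isogeny is. -/
lemma IsRat.of_comp {φ : Pt E₁ →+ Pt E₂} (hφ : IsIsogeny Ω φ) {h : Pt E₂ → Ω}
    (hr : IsRat fun P => h (φ P)) : IsRat h := by
  -- `Y` is odd and generically nonzero. Hence `h(Q) + h(-Q)` and `(h(Q) - h(-Q)) / Y(Q)` are even,
  -- and `h` is recovered from them.
  set Y : Pt E₂ → Ω := fun Q => 2 * yc Q + E₂.a₁ * xc Q + E₂.a₃ with hY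
  have hYr : IsRat Y := ((IsRat.y.const_mul 2).add (IsRat.x.const_mul E₂.a₁)).add
    (IsRat.const E₂.a₃)
  have hr' : IsRat fun P => h (-φ P) := by simpa only [map_neg] using hr.comp_neg
  have h₁ : IsRat fun Q => h Q + h (-Q) :=
    IsRat.of_comp_of_even hφ (fun Q => by rw [neg_neg, add_comm]) (hr.add hr')
  have h₂ : IsRat fun Q => (h Q - h (-Q)) / Y Q := by
    refine IsRat.of_comp_of_even hφ (fun Q => ?_)
      ((hr.sub hr').div (hYr.comp hφ.isRatHom hφ.finite_ker))
    by_cases hQ : Q = 0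
    · rw [hQ, neg_zero, neg_zero]
    · have : Y (-Q) = -Y Q := by
        simp only [hY, yc_neg hQ, xc_neg]; ring
      rw [neg_neg, this, div_neg, ← neg_div, neg_sub]
  refine ((h₁.add (h₂.mul hYr)).const_mul 2⁻¹).congr ?_
  filter_upwards [eventually_map_ne finite_torsion_two 0, eventually_ne_pt 0] with Q hQ hQ'
  have hYQ : Y Q ≠ 0 := mt (torsion_two_iff hQ').mpr hQ
  field_simp
  ring

/-- The dual isogeny. -/
lemma IsIsogeny.exists_dual {φ : Pt E₁ →+ Pt E₂} (hφ : IsIsogeny Ω φ) :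
    ∃ ψ : Pt E₂ →+ Pt E₁, IsIsogeny Ω ψ ∧ ψ.comp φ = mulHom E₁ (Nat.card φ.ker) := by
  have := hφ.finite_ker
  have hn : Nat.card φ.ker ≠ 0 := Nat.card_pos.ne'
  set n := Nat.card φ.ker
  have hle : φ.ker ≤ (mulHom E₁ n).ker := by
    intro P hP
    have : n • (⟨P, hP⟩ : φ.ker) = 0 := card_nsmul_eq_zero'
    exact congrArg Subtype.val this
  obtain ⟨hrat, hk⟩ := isRatHom_mulHom (E := E₁) hn
  -- The order of `ker φ` kills `ker φ`, so multiplication by it factors through `φ` as a group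
  -- homomorphism. Its coordinates are rational by `IsRat.of_comp`.
  let ψ : Pt E₂ →+ Pt E₁ := φ.liftOfSurjective hφ.surjective ⟨mulHom E₁ n, hle⟩
  have hψ : ψ.comp φ = mulHom E₁ n :=
    AddMonoidHom.liftOfRightInverse_comp _ _ _ _
  have hψ' (P : Pt E₁) : ψ (φ P) = mulHom E₁ n P := DFunLike.congr_fun hψ P
  refine ⟨ψ, IsRatHom.isIsogeny ⟨?_, ?_⟩ ?_, hψ⟩
  · refine IsRat.of_comp hφ ?_
    simpa only [hψ'] using hrat.1
  · refine IsRat.of_comp hφ ?_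
    simpa only [hψ'] using hrat.2
  · refine ((Set.toFinite ((mulHom E₁ n).ker : Set (Pt E₁))).image φ).subset fun Q hQ => ?_
    obtain ⟨P, rfl⟩ := hφ.surjective Q
    exact ⟨P, (hψ' P).symm.trans hQ, rfl⟩

end Factor

end QCurve

end

noncomputable section

namespace QCurve

open WeierstrassCurve Polynomial Filter

/-! ### Finite subgroups of abelian groups -/

section Group

variable {A B D : Type*} [AddCommGroup A] [AddCommGroup B] [AddCommGroup D]

lemma mem_torsion {n : ℕ} {a : A} : a ∈ torsion A n ↔ n • a = 0 := Iff.rfl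

lemma le_torsion_card (C : AddSubgroup A) [Finite C] : C ≤ torsion A (Nat.card C) := by
  intro P hP
  have : Nat.card C • (⟨P, hP⟩ : C) = 0 := card_nsmul_eq_zero'
  exact congrArg Subtype.val this

lemma eq_zero_of_coprime_nsmul {a b : ℕ} (hab : a.Coprime b) {x : A} (ha : a • x = 0)
    (hb : b • x = 0) : x = 0 := by
  rw [← AddMonoid.addOrderOf_eq_one_iff]
  exact Nat.eq_one_of_dvd_coprimes hab (addOrderOf_dvd_of_nsmul_eq_zero ha)
    (addOrderOf_dvd_of_nsmul_eq_zero hb)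

lemma exists_generator {C : AddSubgroup A} (hC : IsAddCyclic C) {n : ℕ} (hn : Nat.card C = n) :
    ∃ x, C = AddSubgroup.zmultiples x ∧ addOrderOf x = n := by
  obtain ⟨x, hx⟩ := (AddSubgroup.isAddCyclic_iff_exists_zmultiples_eq_top C).mp hC
  refine ⟨x, hx.symm, ?_⟩
  rw [← Nat.card_zmultiples, hx, hn]

/-- The sum of two finite cyclic subgroups of coprime orders. -/
lemma cyclic_sup {C₁ C₂ : AddSubgroup A} (h₁ : IsAddCyclic C₁) (h₂ : IsAddCyclic C₂) {a b : ℕ}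
    (ha : Nat.card C₁ = a) (hb : Nat.card C₂ = b) (hab : a.Coprime b) :
    IsAddCyclic (C₁ ⊔ C₂ : AddSubgroup A) ∧ Nat.card (C₁ ⊔ C₂ : AddSubgroup A) = a * b := by
  obtain ⟨x, rfl, hx⟩ := exists_generator h₁ ha
  obtain ⟨y, rfl, hy⟩ := exists_generator h₂ hb
  have hord : addOrderOf (x + y) = a * b := by
    rw [(AddCommute.all x y).addOrderOf_add_eq_mul_addOrderOf_of_coprime (by rwa [hx, hy]), hx, hy]
  have hx0 : a • x = 0 := hx ▸ addOrderOf_nsmul_eq_zero x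
  have hy0 : b • y = 0 := hy ▸ addOrderOf_nsmul_eq_zero y
  have hz : AddSubgroup.zmultiples x ⊔ AddSubgroup.zmultiples y =
      AddSubgroup.zmultiples (x + y) := by
    have hbez : (a : ℤ) * a.gcdA b + b * a.gcdB b = 1 := by
      rw [← Nat.gcd_eq_gcd_ab, hab, Nat.cast_one]
    have hx0' : (a : ℤ) • x = 0 := by rw [natCast_zsmul, hx0]
    have hy0' : (b : ℤ) • y = 0 := by rw [natCast_zsmul, hy0]
    refine le_antisymm (sup_le ?_ ?_) ?_
    · rw [AddSubgroup.zmultiples_le]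
      refine ⟨a.gcdB b * b, ?_⟩
      change (a.gcdB b * b) • (x + y) = x
      have : (a.gcdB b * b : ℤ) = 1 - a.gcdA b * a := by linear_combination hbez
      rw [smul_add, mul_smul _ _ y, hy0', this, sub_smul, mul_smul, hx0']
      simp
    · rw [AddSubgroup.zmultiples_le]
      refine ⟨a.gcdA b * a, ?_⟩
      change (a.gcdA b * a) • (x + y) = y
      have : (a.gcdA b * a : ℤ) = 1 - a.gcdB b * b := by linear_combination hbez
      rw [smul_add, mul_smul _ _ x, hx0', this, sub_smul, mul_smul, hy0']
      simp
    · rw [AddSubgroup.zmultiples_le]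
      exact AddSubgroup.add_mem_sup (AddSubgroup.mem_zmultiples x) (AddSubgroup.mem_zmultiples y)
  rw [hz, Nat.card_zmultiples, hord]
  exact ⟨inferInstance, rfl⟩

lemma sup_inf_torsion {C₁ C₂ : AddSubgroup A} {a b : ℕ} (ha : C₁ ≤ torsion A a)
    (hb : C₂ ≤ torsion A b) (hab : a.Coprime b) : (C₁ ⊔ C₂) ⊓ torsion A a = C₁ := by
  refine le_antisymm ?_ (le_inf le_sup_left ha)
  rintro c ⟨hc, hc'⟩
  obtain ⟨p, hp, q, hq, rfl⟩ := AddSubgroup.mem_sup.mp hc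
  have : q = 0 := by
    refine eq_zero_of_coprime_nsmul hab ?_ (hb hq)
    have h : a • (p + q) = 0 := hc'
    rwa [smul_add, show a • p = 0 from ha hp, zero_add] at h
  rw [this, add_zero]
  exact hp

lemma sign_smul_eq_zero {s : ℤ} (hs : s = 1 ∨ s = -1) {a : A} : s • a = 0 ↔ a = 0 := by
  rcases hs with rfl | rfl <;> simp

/-- If `χ ∘ ψ = ± n`, then `ker χ = ψ(A[n])`. -/
lemma ker_eq_map_torsion {ψ : A →+ B} {χ : B →+ A} (hψ : Function.Surjective ψ) {n : ℕ} {s : ℤ}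
    (hs : s = 1 ∨ s = -1) (h : ∀ a, χ (ψ a) = s • n • a) : χ.ker = (torsion A n).map ψ := by
  ext b
  obtain ⟨a, rfl⟩ := hψ b
  rw [AddMonoidHom.mem_ker, h, sign_smul_eq_zero hs]
  constructor
  · exact fun ha => ⟨a, ha, rfl⟩
  · rintro ⟨a', ha', hab⟩
    have : χ (ψ a) = 0 := by rw [← hab, h, show n • a' = 0 from ha', smul_zero]
    rwa [h, sign_smul_eq_zero hs] at this

end Group

/-! ### Conjugation, with the conjugate curve given up to equality -/

section Conj

variable {Ω : Type*} [Field Ω] [DecidableEq Ω]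
variable {W W' W'' W₁ W₂ W₁' W₂' : WeierstrassCurve Ω}

/-- The isomorphism `W(Ω) → W'(Ω)`, `(x, y) ↦ (g x, g y)`, where `W'` is the conjugate of `W`. -/
def conjTo (g : Ω ≃+* Ω) (h : conj g W = W') : Pt W ≃+ Pt W' := h ▸ conjPt g W

lemma xc_conjTo (g : Ω ≃+* Ω) (h : conj g W = W') (P : Pt W) :
    xc (conjTo g h P) = g (xc P) := by
  subst h
  rcases P with _ | ⟨x, y, hP⟩
  · exact (map_zero g).symm
  · rfl

lemma yc_conjTo (g : Ω ≃+* Ω) (h : conj g W = W') (P : Pt W) :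
    yc (conjTo g h P) = g (yc P) := by
  subst h
  rcases P with _ | ⟨x, y, hP⟩
  · exact (map_zero g).symm
  · rfl

lemma conjTo_conjTo {g g' g'' : Ω ≃+* Ω} (h : conj g W = W') (h' : conj g' W' = W'')
    (h'' : conj g'' W = W'') (hg : ∀ x, g'' x = g' (g x)) (P : Pt W) :
    conjTo g' h' (conjTo g h P) = conjTo g'' h'' P := by
  by_cases hP : P = 0
  · simp [hP]
  · refine Pt.ext_coord (by simpa using hP) (by simpa using hP) ?_ ?_
    · simp only [xc_conjTo, hg]
    · simp only [yc_conjTo, hg]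

/-- The conjugate of a homomorphism. -/
def conjHomTo (g : Ω ≃+* Ω) (h₁ : conj g W₁ = W₁') (h₂ : conj g W₂ = W₂')
    (φ : Pt W₁ →+ Pt W₂) : Pt W₁' →+ Pt W₂' :=
  (conjTo g h₂).toAddMonoidHom.comp (φ.comp (conjTo g h₁).symm.toAddMonoidHom)

lemma conjHomTo_conjTo (g : Ω ≃+* Ω) (h₁ : conj g W₁ = W₁') (h₂ : conj g W₂ = W₂')
    (φ : Pt W₁ →+ Pt W₂) (P : Pt W₁) :
    conjHomTo g h₁ h₂ φ (conjTo g h₁ P) = conjTo g h₂ (φ P) := by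
  simp [conjHomTo]

lemma conjHomTo_ker (g : Ω ≃+* Ω) (h₁ : conj g W₁ = W₁') (h₂ : conj g W₂ = W₂')
    (φ : Pt W₁ →+ Pt W₂) :
    (conjHomTo g h₁ h₂ φ).ker = φ.ker.map (conjTo g h₁).toAddMonoidHom := by
  subst h₁ h₂
  exact conjHom_ker g φ

lemma card_conjHomTo_ker (g : Ω ≃+* Ω) (h₁ : conj g W₁ = W₁') (h₂ : conj g W₂ = W₂')
    (φ : Pt W₁ →+ Pt W₂) : Nat.card (conjHomTo g h₁ h₂ φ).ker = Nat.card φ.ker := by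
  rw [conjHomTo_ker]
  exact (Nat.card_congr ((conjTo g h₁).addSubgroupMap φ.ker).toEquiv).symm

lemma IsIsogeny.conjHomTo (g : Ω ≃+* Ω) (h₁ : QCurve.conj g W₁ = W₁')
    (h₂ : QCurve.conj g W₂ = W₂') {φ : Pt W₁ →+ Pt W₂} (hφ : IsIsogeny Ω φ) :
    IsIsogeny Ω (conjHomTo g h₁ h₂ φ) := by
  subst h₁ h₂
  exact hφ.conj g

/-- An isogeny defined over `k` commutes with the automorphisms that fix `k`. -/
lemma IsIsogeny.map_conjTo {k : Type*} [Field k] [Algebra k Ω] [IsAlgClosed Ω]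
    [W₁.IsElliptic] {φ : Pt W₁ →+ Pt W₂} (hφ : IsIsogeny k φ) {g : Ω ≃+* Ω}
    (hg : ∀ a : k, g (algebraMap k Ω a) = algebraMap k Ω a) (h₁ : QCurve.conj g W₁ = W₁)
    (h₂ : QCurve.conj g W₂ = W₂) (P : Pt W₁) : φ (conjTo g h₁ P) = conjTo g h₂ (φ P) := by
  suffices h : φ.comp (conjTo g h₁).toAddMonoidHom = (conjTo g h₂).toAddMonoidHom.comp φ from
    DFunLike.congr_fun h P
  refine addMonoidHom_eq_of_eventuallyEq ?_
  obtain ⟨u, v, w, h⟩ := hφ.rational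
  have ev (p : Polynomial (Polynomial k)) (x y : Ω) :
      (p.map (mapRingHom (algebraMap k Ω))).evalEval (g x) (g y) =
        g ((p.map (mapRingHom (algebraMap k Ω))).evalEval x y) := by
    have := map_mapRingHom_evalEval (g : Ω →+* Ω) (p.map (mapRingHom (algebraMap k Ω))) x y
    rw [Polynomial.map_map, mapRingHom_comp,
      show (g : Ω →+* Ω).comp (algebraMap k Ω) = algebraMap k Ω from RingHom.ext hg] at this
    exact this
  have h' : ∀ᶠ P in cofinite, P ≠ 0 ∧ φ P ≠ 0 ∧
      xc (φ P) = (u.map (mapRingHom (algebraMap k Ω))).evalEval (xc P) (yc P) /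
        (w.map (mapRingHom (algebraMap k Ω))).evalEval (xc P) (yc P) ∧
      yc (φ P) = (v.map (mapRingHom (algebraMap k Ω))).evalEval (xc P) (yc P) /
        (w.map (mapRingHom (algebraMap k Ω))).evalEval (xc P) (yc P) := by
    refine Eventually.mono (show ∀ᶠ P in cofinite, _ from h) ?_
    rintro P ⟨x, y, h₁, h₂, rfl, -, e⟩
    rw [e]
    exact ⟨Affine.Point.some_ne_zero _, Affine.Point.some_ne_zero _, rfl, rfl⟩
  filter_upwards [h', (conjTo g h₁).injective.tendsto_cofinite.eventually h'] with P hP hP'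
  obtain ⟨-, a₁, a₂, a₃⟩ := hP
  obtain ⟨-, b₁, b₂, b₃⟩ := hP'
  refine Pt.ext_coord b₁ (by simpa using a₁) ?_ ?_
  · change xc (φ (conjTo g h₁ P)) = xc (conjTo g h₂ (φ P))
    rw [b₂, xc_conjTo g h₂, a₂, map_div₀, xc_conjTo, yc_conjTo, ev, ev]
  · change yc (φ (conjTo g h₁ P)) = yc (conjTo g h₂ (φ P))
    rw [b₃, yc_conjTo g h₂, a₃, map_div₀, xc_conjTo, yc_conjTo, ev, ev]

lemma CyclicPair.conj_eq {n : ℕ} (g : Ω ≃+* Ω) (p : CyclicPair Ω n) (hg : QCurve.conj g p.E = W') :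
    ∃ (h₁ : W'.IsElliptic) (h₂ : IsAddCyclic (p.C.map (conjTo g hg).toAddMonoidHom))
      (h₃ : Nat.card (p.C.map (conjTo g hg).toAddMonoidHom) = n),
      p.conj g = ⟨W', h₁, p.C.map (conjTo g hg).toAddMonoidHom, h₂, h₃⟩ := by
  subst hg
  exact ⟨(p.conj g).elliptic, (p.conj g).cyclic, (p.conj g).card, rfl⟩

/-- A criterion for `(W, C)` to give a rational point on `X₀(n)/w_d`. -/
lemma corresponds_of_forall [Algebra ℚ Ω] [hW : W.IsElliptic] {n d : ℕ} {C : AddSubgroup (Pt W)}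
    (hC : IsAddCyclic C) (hn : Nat.card C = n)
    (H : ∀ g : Ω ≃ₐ[ℚ] Ω,
      (∃ h : conj (g : Ω ≃+* Ω) W = W, C.map (conjTo (g : Ω ≃+* Ω) h).toAddMonoidHom = C) ∨
      ∃ (W' : WeierstrassCurve Ω) (h : conj (g : Ω ≃+* Ω) W = W'),
        IsQuotientBy d (n / d) C (C.map (conjTo (g : Ω ≃+* Ω) h).toAddMonoidHom)) :
    Corresponds W n d := by
  let p : CyclicPair Ω n := ⟨W, hW, C, hC, hn⟩
  refine ⟨Y0Quot.mk d (Quotient.mk _ p), fun g => ?_, Quotient.mk _ p, rfl, rfl⟩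
  rcases H g with ⟨h, hCg⟩ | ⟨W', h, hq⟩
  · obtain ⟨h₁, h₂, h₃, e⟩ := p.conj_eq (g : Ω ≃+* Ω) h
    have : p.conj (g : Ω ≃+* Ω) = p := by
      rw [e]
      simp only [p, hCg]
    change Y0Quot.mk d (Quotient.mk _ (p.conj (g : Ω ≃+* Ω))) = _
    rw [this]
  · subst h
    exact (Quot.sound ⟨p, p.conj (g : Ω ≃+* Ω), rfl, rfl, hq⟩).symm

end Conj

/-! ### Isogenies from a curve without complex multiplication to its conjugate -/

section NoCM

variable {Ω : Type*} [Field Ω] [DecidableEq Ω] [IsAlgClosed Ω] [CharZero Ω]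
variable {W W' : WeierstrassCurve Ω} [W.IsElliptic] {d : ℕ}

/-- Without complex multiplication `ν ∘ μ` is an integer `n`. Its kernel `W[n]` has order `n²`, and
also order `d²` as the kernel of a composite, so `n = ±d`. -/
lemma comp_eq_of_not_hasCM (hCM : ¬ HasCM W) {μ : Pt W →+ Pt W'} {ν : Pt W' →+ Pt W}
    (hμ : IsIsogeny Ω μ) (hν : IsIsogeny Ω ν) (cμ : Nat.card μ.ker = d) (cν : Nat.card ν.ker = d) :
    ∃ s : ℤ, (s = 1 ∨ s = -1) ∧ ∀ P, ν (μ P) = s • d • P := by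
  obtain ⟨n, hn⟩ : ∃ n : ℤ, ν.comp μ = n • AddMonoidHom.id (Pt W) := by
    by_contra! h
    exact hCM ⟨_, hν.comp hμ, h⟩
  have hn' (P : Pt W) : ν (μ P) = n • P := DFunLike.congr_fun hn P
  have hfin := (hν.comp hμ).finite_ker
  have hcard := card_ker_comp (ψ := ν) (φ := μ) hμ.surjective
  have hker : (ν.comp μ).ker = torsion (Pt W) n.natAbs := by
    ext P
    rw [AddMonoidHom.mem_ker, AddMonoidHom.comp_apply, hn', mem_torsion]
    rcases Int.natAbs_eq n with h | h <;> rw [h] <;> simp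
  have hn0 : n.natAbs ≠ 0 := by
    intro h
    rw [hker, h] at hfin
    have : torsion (Pt W) 0 = ⊤ := by ext; simp [mem_torsion]
    rw [this] at hfin
    exact not_finite_iff_infinite.mpr (infinite_pt (E := W))
      (Finite.of_equiv _ AddSubgroup.topEquiv.toEquiv)
  rw [hker, card_torsion hn0, cμ, cν, ← sq] at hcard
  have hd : n.natAbs = d := Nat.pow_left_injective two_ne_zero hcard
  rcases Int.natAbs_eq n with h | h
  · exact ⟨1, .inl rfl, fun P => by rw [hn', h, hd]; simp⟩
  · exact ⟨-1, .inr rfl, fun P => by rw [hn', h, hd]; simp⟩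

/-- The auxiliary `ν` turns `μ` and `μ'` into endomorphisms, both equal to `±d`. So `μ'` and `±μ`
differ by a homomorphism with values in the finite group `ker ν`. -/
lemma eq_or_eq_neg_of_not_hasCM (hCM : ¬ HasCM W) {μ μ' : Pt W →+ Pt W'} {ν : Pt W' →+ Pt W}
    (hμ : IsIsogeny Ω μ) (hμ' : IsIsogeny Ω μ') (hν : IsIsogeny Ω ν) (cμ : Nat.card μ.ker = d)
    (cμ' : Nat.card μ'.ker = d) (cν : Nat.card ν.ker = d) :
    ∃ s : ℤ, (s = 1 ∨ s = -1) ∧ ∀ P, μ' P = s • μ P := by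
  obtain ⟨s, hs, h⟩ := comp_eq_of_not_hasCM hCM hμ hν cμ cν
  obtain ⟨s', hs', h'⟩ := comp_eq_of_not_hasCM hCM hμ' hν cμ' cν
  have hss : s * s = 1 := by rcases hs with rfl | rfl <;> rfl
  have := hν.finite_ker
  have hd : d ≠ 0 := cν ▸ Nat.card_pos.ne'
  refine ⟨s' * s, ?_, fun P => ?_⟩
  · rcases hs with rfl | rfl <;> rcases hs' with rfl | rfl <;> simp
  -- Writing the point as a multiple by `d` removes the difference, because `ker ν` is killed by its
  -- order `d`.
  · obtain ⟨P, rfl⟩ := nsmul_surjective (E := W) hd P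
    have hmem : μ' P - (s' * s) • μ P ∈ ν.ker := by
      rw [AddMonoidHom.mem_ker, map_sub, map_zsmul, h, h', ← mul_smul (s' * s) s, mul_assoc, hss,
        mul_one, sub_self]
    have h0 := le_torsion_card _ hmem
    rw [cν, mem_torsion, smul_sub, sub_eq_zero] at h0
    change μ' (d • P) = (s' * s) • μ (d • P)
    rw [map_nsmul, map_nsmul, h0, smul_comm]

end NoCM

end QCurve

end

noncomputable section

namespace QCurve

open WeierstrassCurve

/-! ### The kernel of the composite `E' → E → E^σ → E'^σ` -/

section Kernel

variable {A A' B B' : Type*} [AddCommGroup A] [AddCommGroup A'] [AddCommGroup B] [AddCommGroup B']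

lemma comp_dual {φ : A →+ B} {ψ : B →+ A} (hφ : Function.Surjective φ) {m : ℕ}
    (h : ∀ a, ψ (φ a) = m • a) (b : B) : φ (ψ b) = m • b := by
  obtain ⟨a, rfl⟩ := hφ b
  rw [h, map_nsmul]

/-- A generator of the kernel is `φ x + P`. Here `x` generates `ker μ`, so `φ x` has order `d`, and
`P` is chosen so that `μ(ψ P)` generates `ker φ'`. As `m P = φ(ψ P)` is nonzero and killed by `m`,
`P` has order `m²`. The order of the sum is then `d m²`, the order of the kernel. -/
lemma hasCyclicKernel_comp {φ : A →+ B} {ψ : B →+ A} {μ : A →+ A'} {φ' : A' →+ B'} {d m : ℕ}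
    (hm : m.Prime) (hmd : m.Coprime d) (hd : d ≠ 0)
    (sφ : Function.Surjective φ) (sψ : Function.Surjective ψ) (sμ : Function.Surjective μ)
    (hψφ : ∀ a, ψ (φ a) = m • a) (cφ : Nat.card φ.ker = m) (cψ : Nat.card ψ.ker = m)
    (hμ : HasCyclicKernel μ d) (cφ' : Nat.card φ'.ker = m) (hne : φ.ker.map μ ≠ φ'.ker) :
    HasCyclicKernel (φ'.comp (μ.comp ψ)) (d * m ^ 2) := by
  have : Fact m.Prime := ⟨hm⟩
  have hcard : Nat.card (φ'.comp (μ.comp ψ)).ker = d * m ^ 2 := by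
    rw [card_ker_comp (φ := μ.comp ψ) (sμ.comp sψ), card_ker_comp sψ, cψ, cφ', hμ.2]
    ring
  have hfφ : Finite φ.ker := Nat.finite_of_card_ne_zero (by rw [cφ]; exact hm.ne_zero)
  have hfφ' : Finite φ'.ker := Nat.finite_of_card_ne_zero (by rw [cφ']; exact hm.ne_zero)
  have hfμ : Finite μ.ker := Nat.finite_of_card_ne_zero (by rw [hμ.2]; exact hd)
  have hφψ := comp_dual sφ hψφ
  obtain ⟨x, hx, hxd⟩ := exists_generator hμ.1 hμ.2
  have hxμ : μ x = 0 := by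
    have : x ∈ μ.ker := hx ▸ AddSubgroup.mem_zmultiples x
    exact this
  -- `φ` loses nothing of the order, as `ker φ` is killed by `m`, which is prime to `d`.
  have hφx : addOrderOf (φ x) = d := by
    refine Nat.dvd_antisymm ?_ ?_
    · rw [← hxd]
      exact addOrderOf_map_dvd φ x
    · rw [← hxd]
      refine addOrderOf_dvd_of_nsmul_eq_zero ?_
      set o := addOrderOf (φ x)
      refine eq_zero_of_coprime_nsmul hmd ?_ ?_
      · have h : o • x ∈ φ.ker := by
          rw [AddMonoidHom.mem_ker, map_nsmul]
          exact addOrderOf_nsmul_eq_zero _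
        have h' := le_torsion_card _ h
        rwa [cφ] at h'
      · rw [smul_comm, ← hxd, addOrderOf_nsmul_eq_zero, smul_zero]
  obtain ⟨Q, hQ, hQm⟩ := exists_generator (isAddCyclic_of_prime_card cφ') cφ'
  have hQφ : φ' Q = 0 := by
    have : Q ∈ φ'.ker := hQ ▸ AddSubgroup.mem_zmultiples Q
    exact this
  obtain ⟨R, hRm, rfl⟩ : ∃ R, m • R = 0 ∧ μ R = Q := by
    obtain ⟨R₀, rfl⟩ := sμ Q
    have hmQ : m • μ R₀ = 0 := hQm ▸ addOrderOf_nsmul_eq_zero _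
    have h₀ : d • m • R₀ = 0 := by
      have h : m • R₀ ∈ μ.ker := by rw [AddMonoidHom.mem_ker, map_nsmul, hmQ]
      have h' := le_torsion_card _ h
      rwa [hμ.2] at h'
    have hbez : (m : ℤ) * m.gcdA d + d * m.gcdB d = 1 := by
      rw [← Nat.gcd_eq_gcd_ab, hmd, Nat.cast_one]
    -- The multiplier is a multiple of `d` congruent to 1 modulo `m`. It moves `R₀`, killed by `dm`,
    -- into the `m`-torsion without changing its image `Q`, which is killed by `m`.
    refine ⟨(m.gcdB d * d) • R₀, ?_, ?_⟩
    · rw [smul_comm, mul_smul, natCast_zsmul, h₀, smul_zero]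
    · rw [map_zsmul, show m.gcdB d * d = 1 - m.gcdA d * m by linear_combination hbez, sub_smul,
        mul_smul, natCast_zsmul, hmQ, smul_zero, one_smul, sub_zero]
  -- The only use of `hne`: if `R` were in `ker φ`, then `μ(ker φ)` would contain a generator of
  -- `ker φ'`, and the two groups would agree by comparing orders.
  have hφR : φ R ≠ 0 := by
    intro h0
    have : Finite (φ.ker.map μ) := Set.Finite.image μ (Set.toFinite (φ.ker : Set A))
    refine hne (AddSubgroup.eq_of_le_of_card_ge (H := φ'.ker) (K := φ.ker.map μ) ?_ ?_).symm
    · rw [hQ, AddSubgroup.zmultiples_le]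
      exact ⟨R, h0, rfl⟩
    · rw [cφ', ← cφ]
      exact Nat.card_le_card_of_surjective _ (μ.addSubgroupMap_surjective φ.ker)
  obtain ⟨P, rfl⟩ := sψ R
  have hP : addOrderOf P = m ^ (1 + 1) := by
    refine addOrderOf_eq_prime_pow ?_ ?_
    · rw [pow_one, ← hφψ]
      exact hφR
    · rw [pow_succ, pow_one, mul_smul, ← hφψ P, ← map_nsmul, hRm, map_zero]
  have hz : addOrderOf (φ x + P) = d * m ^ 2 := by
    rw [(AddCommute.all _ _).addOrderOf_add_eq_mul_addOrderOf_of_coprime, hφx, hP]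
    rw [hφx, hP]
    exact (Nat.Coprime.pow_left _ hmd).symm
  have hfin : Finite (φ'.comp (μ.comp ψ)).ker := Nat.finite_of_card_ne_zero (by
    rw [hcard]
    exact mul_ne_zero hd (pow_ne_zero 2 hm.ne_zero))
  have hzker : φ x + P ∈ (φ'.comp (μ.comp ψ)).ker := by
    simp [AddMonoidHom.mem_ker, hψφ, hxμ, hQφ]
  refine ⟨isAddCyclic_of_addOrderOf_eq_card (⟨φ x + P, hzker⟩ : (φ'.comp (μ.comp ψ)).ker) ?_, hcard⟩
  rw [AddSubgroup.addOrderOf_mk, hz, hcard]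

lemma map_eq_of_mem_iff {C : AddSubgroup A} (T : A ≃+ A) (h : ∀ a, T a ∈ C ↔ a ∈ C) :
    C.map T.toAddMonoidHom = C := by
  ext a
  obtain ⟨a, rfl⟩ := T.surjective a
  rw [h]
  exact AddSubgroup.mem_map_equiv.trans (by simp)

end Kernel

/-! ### Galois conditions on a kernel that yield rational points on the quotients. -/

section Points

variable {Ω : Type*} [Field Ω] [DecidableEq Ω] [Algebra ℚ Ω]
variable {W W' : WeierstrassCurve Ω} [W.IsElliptic] {d m : ℕ}

/-- The pair `(W, ker μ + C)`, where `C` is a cyclic group of order prime to `d`. -/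
lemma corresponds_of_sup {μ : Pt W →+ Pt W'} (hμ : IsIsogeny Ω μ) (hμd : HasCyclicKernel μ d)
    (hd : d ≠ 0) (hm : m ≠ 0) (hmd : m.Coprime d) {C : AddSubgroup (Pt W)} (hC : IsAddCyclic C)
    (hCm : Nat.card C = m)
    (H : ∀ g : Ω ≃ₐ[ℚ] Ω,
      (∃ h : conj (g : Ω ≃+* Ω) W = W, C.map (conjTo (g : Ω ≃+* Ω) h).toAddMonoidHom = C ∧
        μ.ker.map (conjTo (g : Ω ≃+* Ω) h).toAddMonoidHom = μ.ker) ∨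
      ∃ h : conj (g : Ω ≃+* Ω) W = W', C.map (conjTo (g : Ω ≃+* Ω) h).toAddMonoidHom = C.map μ ∧
        μ.ker.map (conjTo (g : Ω ≃+* Ω) h).toAddMonoidHom = (torsion (Pt W) d).map μ) :
    Corresponds W (d * m) d := by
  have h₁ : μ.ker ≤ torsion (Pt W) d := by
    have := hμ.finite_ker
    simpa only [hμd.2] using le_torsion_card μ.ker
  have h₂ : C ≤ torsion (Pt W) m := by
    have : Finite C := Nat.finite_of_card_ne_zero (by rwa [hCm])
    simpa only [hCm] using le_torsion_card C
  obtain ⟨hcyc, hcard⟩ := cyclic_sup hμd.1 hC hμd.2 hCm hmd.symm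
  refine corresponds_of_forall hcyc hcard fun g => (H g).imp ?_ ?_
  · rintro ⟨h, e₁, e₂⟩
    exact ⟨h, by rw [AddSubgroup.map_sup, e₁, e₂]⟩
  · rintro ⟨h, e₁, e₂⟩
    refine ⟨W', h, μ, hμ, (sup_inf_torsion h₁ h₂ hmd.symm).symm, ?_⟩
    rw [Nat.mul_div_cancel_left _ (Nat.pos_of_ne_zero hd), sup_comm μ.ker C,
      sup_inf_torsion h₂ h₁ hmd, AddSubgroup.map_sup, e₁, e₂, sup_comm]

/-- The pair `(W, ker ψ)` gives a point on `X₀⁺(n)`. -/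
lemma corresponds_of_ker {n : ℕ} {ψ : Pt W →+ Pt W'} (hψ : IsIsogeny Ω ψ)
    (hψn : HasCyclicKernel ψ n)
    (H : ∀ g : Ω ≃ₐ[ℚ] Ω,
      (∃ h : conj (g : Ω ≃+* Ω) W = W,
        ψ.ker.map (conjTo (g : Ω ≃+* Ω) h).toAddMonoidHom = ψ.ker) ∨
      ∃ h : conj (g : Ω ≃+* Ω) W = W',
        ψ.ker.map (conjTo (g : Ω ≃+* Ω) h).toAddMonoidHom = (torsion (Pt W) n).map ψ) :
    Corresponds W n n := by
  have h₁ : ψ.ker ≤ torsion (Pt W) n := by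
    have := hψ.finite_ker
    simpa only [hψn.2] using le_torsion_card ψ.ker
  refine corresponds_of_forall hψn.1 hψn.2 fun g => (H g).imp id ?_
  rintro ⟨h, e⟩
  refine ⟨W', h, ψ, hψ, (inf_eq_left.mpr h₁).symm, ?_⟩
  -- The second summand in the description of `w_n` is the image of a part of `ker ψ`, so only
  -- `ψ(W[n])` remains.
  have h0 : (ψ.ker ⊓ torsion (Pt W) (n / n)).map ψ = ⊥ := by
    rw [eq_bot_iff]
    rintro _ ⟨a, ha, rfl⟩
    exact ha.1
  rw [h0, sup_bot_eq, e]

end Points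

/-! ### Automorphisms over a quadratic field and the dichotomy. -/

section Quadratic

variable {K : Type*} [Field K]

lemma conj_map {Ω : Type*} [Field Ω] {f f' : K →+* Ω} {g : Ω ≃+* Ω} (F : WeierstrassCurve K)
    (h : ∀ a, g (f a) = f' a) : conj g (F.map f) = F.map f' := by
  ext <;> exact h _

variable [NumberField K]

/-- An automorphism of a quadratic field is the identity or the given non-trivial one. -/
lemma eq_one_or_eq (hK : Module.finrank ℚ K = 2) {σ : K ≃ₐ[ℚ] K} (hσ : σ ≠ 1) (s : K ≃ₐ[ℚ] K) :
    s = 1 ∨ s = σ := by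
  have : Algebra.IsQuadraticExtension ℚ K := ⟨hK⟩
  have hcard : Nat.card (K ≃ₐ[ℚ] K) = 2 := (IsGalois.card_aut_eq_finrank ℚ K).trans hK
  by_contra! h
  have : Fintype (K ≃ₐ[ℚ] K) := Fintype.ofFinite _
  classical
  have h3 : ({1, σ, s} : Finset (K ≃ₐ[ℚ] K)).card = 3 :=
    Finset.card_eq_three.mpr ⟨1, σ, s, hσ.symm, h.1.symm, h.2.symm, rfl⟩
  have := Finset.card_le_univ ({1, σ, s} : Finset (K ≃ₐ[ℚ] K))
  rw [h3, ← Nat.card_eq_fintype_card, hcard] at this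
  omega

lemma restrict_eq_or (hK : Module.finrank ℚ K = 2) {σ : K ≃ₐ[ℚ] K} (hσ : σ ≠ 1)
    (g : AlgebraicClosure K ≃ₐ[ℚ] AlgebraicClosure K) :
    (∀ a : K, (g : AlgebraicClosure K ≃+* AlgebraicClosure K) (algebraMap K _ a) =
      algebraMap K _ a) ∨
      ∀ a : K, (g : AlgebraicClosure K ≃+* AlgebraicClosure K) (algebraMap K _ a) =
        algebraMap K _ (σ a) := by
  have : Algebra.IsQuadraticExtension ℚ K := ⟨hK⟩
  rcases eq_one_or_eq hK hσ (g.restrictNormal K) with h | h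
  · left
    intro a
    rw [AlgEquiv.coe_ringEquiv, ← AlgEquiv.restrictNormal_commutes, h]
    rfl
  · right
    intro a
    rw [AlgEquiv.coe_ringEquiv, ← AlgEquiv.restrictNormal_commutes, h]

lemma apply_apply_of_ne_one (hK : Module.finrank ℚ K = 2) {σ : K ≃ₐ[ℚ] K} (hσ : σ ≠ 1) (a : K) :
    σ (σ a) = a := by
  rcases eq_one_or_eq hK hσ (σ * σ) with h | h
  · exact DFunLike.congr_fun h a
  · exact absurd (mul_left_cancel (h.trans (mul_one σ).symm)) hσ

lemma exists_lift (σ : K ≃ₐ[ℚ] K) : ∃ g : AlgebraicClosure K ≃+* AlgebraicClosure K,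
    ∀ a : K, g (algebraMap K _ a) = algebraMap K _ (σ a) := by
  have : IsAlgClosure ℚ (AlgebraicClosure K) :=
    ⟨inferInstance, Algebra.IsAlgebraic.trans ℚ K (AlgebraicClosure K)⟩
  have : Normal ℚ (AlgebraicClosure K) := IsAlgClosure.normal ℚ _
  exact ⟨(σ.liftNormal (AlgebraicClosure K) : _ ≃+* _), fun a => σ.liftNormal_commutes _ a⟩

variable [DecidableEq (AlgebraicClosure K)]

lemma corresponds_or_exists_isogenous (hK : Module.finrank ℚ K = 2) (E : WeierstrassCurve K)
    [E.IsElliptic] (d m : ℕ) (hm : m.Prime) (hmd : m.Coprime d) (hCM : ¬ HasCM (geom E))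
    (hE : IsQCurveOfDegree E d) (hiso : HasIsogenyOfDegree E m) :
    Corresponds (geom E) (d * m) d ∨
      ∃ (E' : WeierstrassCurve K) (_ : E'.IsElliptic), IsogenousOver E E' ∧
        Corresponds (geom E') (d * m ^ 2) (d * m ^ 2) := by
  obtain ⟨σ, hσ, μ, hμ, hμd⟩ := hE
  obtain ⟨E', hE', φ, hφK, hφm⟩ := hiso
  have hφ : IsIsogeny (AlgebraicClosure K) φ := hφK.of_subfield
  have hσσ := apply_apply_of_ne_one hK hσ
  have hd : d ≠ 0 := by
    have := hμ.finite_ker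
    exact hμd.2 ▸ Nat.card_pos.ne'
  have hfix (F : WeierstrassCurve K) {g : AlgebraicClosure K ≃+* AlgebraicClosure K}
      (hg : ∀ a : K, g (algebraMap K _ a) = algebraMap K _ a) : conj g (geom F) = geom F :=
    conj_map F hg
  have hlift (F : WeierstrassCurve K) {g : AlgebraicClosure K ≃+* AlgebraicClosure K}
      (hg : ∀ a : K, g (algebraMap K _ a) = algebraMap K _ (σ a)) :
      conj g (geom F) = geom (F.map (σ : K →+* K)) :=
    conj_map (f' := (algebraMap K (AlgebraicClosure K)).comp (σ : K →+* K)) F hg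
  have hlift' (F : WeierstrassCurve K) {g : AlgebraicClosure K ≃+* AlgebraicClosure K}
      (hg : ∀ a : K, g (algebraMap K _ a) = algebraMap K _ (σ a)) :
      conj g (geom (F.map (σ : K →+* K))) = geom F :=
    conj_map (f := (algebraMap K (AlgebraicClosure K)).comp (σ : K →+* K)) F fun a =>
      (hg (σ a)).trans (by rw [hσσ])
  -- For `g` extending `σ`, the conjugate `μ^g` goes back from `E^σ` to `E`, because `σ² = 1`.
  have hμlift {g : AlgebraicClosure K ≃+* AlgebraicClosure K}
      (hg : ∀ a : K, g (algebraMap K _ a) = algebraMap K _ (σ a)) :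
      ∃ s : ℤ, (s = 1 ∨ s = -1) ∧
        ∀ P, conjHomTo g (hlift E hg) (hlift' E hg) μ (μ P) = s • d • P :=
    comp_eq_of_not_hasCM hCM hμ (hμ.conjHomTo g _ _) hμd.2
      ((card_conjHomTo_ker g _ _ μ).trans hμd.2)
  -- This lift serves only to supply an isogeny `E^σ → E` of degree `d`, through which `μ` and its
  -- conjugates are compared.
  obtain ⟨ρ₀, hρ₀⟩ := exists_lift σ
  have hμfix {g : AlgebraicClosure K ≃+* AlgebraicClosure K}
      (hg : ∀ a : K, g (algebraMap K _ a) = algebraMap K _ a) :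
      ∃ s : ℤ, (s = 1 ∨ s = -1) ∧
        ∀ P, conjTo g (hfix _ hg) (μ P) = s • μ (conjTo g (hfix E hg) P) := by
    obtain ⟨s, hs, h⟩ := eq_or_eq_neg_of_not_hasCM hCM hμ (hμ.conjHomTo g (hfix E hg) (hfix _ hg))
      (hμ.conjHomTo ρ₀ (hlift E hρ₀) (hlift' E hρ₀)) hμd.2
      ((card_conjHomTo_ker g _ _ μ).trans hμd.2) ((card_conjHomTo_ker ρ₀ _ _ μ).trans hμd.2)
    exact ⟨s, hs, fun P => by rw [← h, conjHomTo_conjTo]⟩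
  have hφfix {g : AlgebraicClosure K ≃+* AlgebraicClosure K}
      (hg : ∀ a : K, g (algebraMap K _ a) = algebraMap K _ a) (P : Pt (geom E)) :
      φ (conjTo g (hfix E hg) P) = conjTo g (hfix E' hg) (φ P) :=
    hφK.map_conjTo hg _ _ P
  by_cases hcase : ∀ (g : AlgebraicClosure K ≃+* AlgebraicClosure K)
      (hg : ∀ a : K, g (algebraMap K _ a) = algebraMap K _ (σ a)),
      φ.ker.map (conjTo g (hlift E hg)).toAddMonoidHom = φ.ker.map μ
  · left
    refine corresponds_of_sup hμ hμd hd hm.ne_zero hmd hφm.1 hφm.2 fun g => ?_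
    refine (restrict_eq_or hK hσ g).imp (fun hg => ?_) fun hg => ?_
    · refine ⟨hfix E hg, map_eq_of_mem_iff _ fun P => ?_, map_eq_of_mem_iff _ fun P => ?_⟩
      · rw [AddMonoidHom.mem_ker, hφfix hg, EmbeddingLike.map_eq_zero_iff, AddMonoidHom.mem_ker]
      · obtain ⟨s, hs, h⟩ := hμfix hg
        rw [AddMonoidHom.mem_ker, ← sign_smul_eq_zero hs, ← h, EmbeddingLike.map_eq_zero_iff,
          AddMonoidHom.mem_ker]
    · obtain ⟨s, hs, h⟩ := hμlift hg
      refine ⟨hlift E hg, hcase _ hg, ?_⟩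
      rw [← conjHomTo_ker _ (hlift E hg) (hlift' E hg) μ]
      exact ker_eq_map_torsion hμ.surjective hs h
  · right
    push Not at hcase
    obtain ⟨ρ, hρ, hne⟩ := hcase
    refine ⟨E', hE', ⟨φ, hφK⟩, ?_⟩
    obtain ⟨ψ, hψ, hψφ'⟩ := hφ.exists_dual
    rw [hφm.2] at hψφ'
    have hψφ (P : Pt (geom E)) : ψ (φ P) = m • P := DFunLike.congr_fun hψφ' P
    have hφψ := comp_dual hφ.surjective hψφ
    have cψ : Nat.card ψ.ker = m := by
      -- The orders of `ker φ` and `ker ψ` multiply to `|E[m]| = m²`.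
      have h := card_ker_comp (ψ := ψ) (φ := φ) hφ.surjective
      rw [hψφ', hφm.2, show Nat.card (mulHom (geom E) m).ker = m ^ 2 from card_torsion hm.ne_zero,
        sq] at h
      exact (Nat.eq_of_mul_eq_mul_left hm.pos h).symm
    set φ' := conjHomTo ρ (hlift E hρ) (hlift E' hρ) φ with hφ'
    have hφ'ρ (P : Pt (geom E)) :
        φ' (conjTo ρ (hlift E hρ) P) = conjTo ρ (hlift E' hρ) (φ P) :=
      conjHomTo_conjTo ρ _ _ φ P
    have hφ'iso : IsIsogeny (AlgebraicClosure K) φ' := hφ.conjHomTo ρ _ _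
    -- `φ'` does not depend on the lift of `σ`: `ρ⁻¹g` fixes `K`, so it commutes with `φ`.
    have hφ'lift {g : AlgebraicClosure K ≃+* AlgebraicClosure K}
        (hg : ∀ a : K, g (algebraMap K _ a) = algebraMap K _ (σ a)) (P : Pt (geom E)) :
        φ' (conjTo g (hlift E hg) P) = conjTo g (hlift E' hg) (φ P) := by
      have hτ (a : K) : (g.trans ρ.symm) (algebraMap K _ a) = algebraMap K _ a := by
        rw [RingEquiv.trans_apply, hg, RingEquiv.symm_apply_eq, hρ]
      have hx (x) : g x = ρ ((g.trans ρ.symm) x) := by simp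
      rw [← conjTo_conjTo (hfix E hτ) (hlift E hρ) (hlift E hg) hx, hφ'ρ, hφfix hτ,
        conjTo_conjTo (hfix E' hτ) (hlift E' hρ) (hlift E' hg) hx]
    have hφlift {g : AlgebraicClosure K ≃+* AlgebraicClosure K}
        (hg : ∀ a : K, g (algebraMap K _ a) = algebraMap K _ (σ a))
        (P : Pt (geom (E.map (σ : K →+* K)))) :
        φ (conjTo g (hlift' E hg) P) = conjTo g (hlift' E' hg) (φ' P) := by
      obtain ⟨P, rfl⟩ := (conjTo ρ (hlift E hρ)).surjective P
      have hτ (a : K) : (ρ.trans g) (algebraMap K _ a) = algebraMap K _ a := by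
        rw [RingEquiv.trans_apply, hρ, hg, hσσ]
      rw [conjTo_conjTo _ _ (hfix E hτ) (fun x => rfl), hφfix hτ, hφ'ρ,
        conjTo_conjTo _ _ (hfix E' hτ) (fun x => rfl)]
    have hφ'fix {g : AlgebraicClosure K ≃+* AlgebraicClosure K}
        (hg : ∀ a : K, g (algebraMap K _ a) = algebraMap K _ a)
        (P : Pt (geom (E.map (σ : K →+* K)))) :
        φ' (conjTo g (hfix _ hg) P) = conjTo g (hfix _ hg) (φ' P) := by
      obtain ⟨P, rfl⟩ := (conjTo ρ (hlift E hρ)).surjective P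
      have hτ (a : K) : (ρ.trans g) (algebraMap K _ a) = algebraMap K _ (σ a) := by
        rw [RingEquiv.trans_apply, hρ, hg]
      rw [conjTo_conjTo _ _ (hlift E hτ) (fun x => rfl), hφ'lift hτ, hφ'ρ,
        conjTo_conjTo _ _ (hlift E' hτ) (fun x => rfl)]
    have hψfix {g : AlgebraicClosure K ≃+* AlgebraicClosure K}
        (hg : ∀ a : K, g (algebraMap K _ a) = algebraMap K _ a) (P : Pt (geom E')) :
        ψ (conjTo g (hfix E' hg) P) = conjTo g (hfix E hg) (ψ P) := by
      obtain ⟨P, rfl⟩ := hφ.surjective P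
      rw [← hφfix hg, hψφ, hψφ, map_nsmul]
    have hne' : φ.ker.map μ ≠ φ'.ker := by
      rw [hφ', conjHomTo_ker]
      exact hne.symm
    have cφ' : Nat.card φ'.ker = m := (card_conjHomTo_ker ρ _ _ φ).trans hφm.2
    have hcyc := hasCyclicKernel_comp hm hmd hd hφ.surjective hψ.surjective hμ.surjective hψφ
      hφm.2 cψ hμd cφ' hne'
    have hχ := hφ'iso.comp (hμ.comp hψ)
    refine corresponds_of_ker hχ hcyc fun g => ?_
    refine (restrict_eq_or hK hσ g).imp (fun hg => ?_) fun hg => ?_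
    · obtain ⟨s, hs, h⟩ := hμfix hg
      refine ⟨hfix E' hg, map_eq_of_mem_iff _ fun P => ?_⟩
      simp only [AddMonoidHom.mem_ker, AddMonoidHom.comp_apply]
      rw [hψfix hg, ← sign_smul_eq_zero hs, ← map_zsmul, ← h, hφ'fix hg,
        EmbeddingLike.map_eq_zero_iff]
    · obtain ⟨s, hs, h⟩ := hμlift hg
      refine ⟨hlift E' hg, ?_⟩
      rw [← conjHomTo_ker _ (hlift E' hg) (hlift' E' hg)]
      refine ker_eq_map_torsion hχ.surjective hs fun Z => ?_
      -- With `μ(ψ Z) = g S`, one has `χ Z = φ'(g S) = g(φ S)`. Hence `χ^g(χ Z) = g(χ(φ S)) = m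
      -- g(φ'(μ S)) = m φ(g(μ S))`. Since `g(μ S) = μ^g(μ(ψ Z)) = s d ψ Z` and `φ ∘ ψ = m`, this is
      -- `s d m² Z`.
      obtain ⟨S, hS⟩ := (conjTo _ (hlift E hg)).surjective (μ (ψ Z))
      have h₁ := h (ψ Z)
      rw [← hS, conjHomTo_conjTo] at h₁
      simp only [AddMonoidHom.comp_apply]
      rw [← hS, hφ'lift hg, conjHomTo_conjTo]
      simp only [AddMonoidHom.comp_apply]
      rw [hψφ, map_nsmul, map_nsmul, map_nsmul, ← hφlift hg, h₁, map_zsmul, map_nsmul, hφψ,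
        smul_comm m s, smul_comm m d, ← mul_smul m m, ← mul_smul d, ← sq]

end Quadratic

end QCurve

end

theorem mainTheorem5 (K : Type*) [Field K] [NumberField K] (hK : Module.finrank ℚ K = 2)
    [DecidableEq (AlgebraicClosure K)] (E : WeierstrassCurve K) [E.IsElliptic]
    (d m : ℕ) (hm : m.Prime) (hmd : m.Coprime d)
    (hCM : ¬ QCurve.HasCM (QCurve.geom E))
    (hE : QCurve.IsQCurveOfDegree E d)
    (hiso : QCurve.HasIsogenyOfDegree E m) :
    QCurve.Corresponds (QCurve.geom E) (d * m) d ∨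
      ∃ (E' : WeierstrassCurve K) (_ : E'.IsElliptic), QCurve.IsogenousOver E E' ∧
        QCurve.Corresponds (QCurve.geom E') (d * m ^ 2) (d * m ^ 2) :=
  QCurve.corresponds_or_exists_isogenous hK E d m hm hmd hCM hE hiso
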